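/- Let $N\ge 2$ and $D\ge 1$ be integers, let $A$ be an $N\times N$ matrix with entries in $\{0,1\}$ having exactly $D$ entries equal to $1$, in the positions $(a_0,b_0)<\dots<(a_{D-1},b_{D-1})$ in lexicographic order, $a_j,b_j\in\{0,\dots,N-1\}$. Let $$\mathbb S_A=\Bigl\{\Bigl(\sum_{i\ge1}\frac{x_i}{N^i},\sum_{i\ge1}\frac{y_i}{N^i}\Bigr):\ x_i,y_i\in\{0,\dots,N-1\},\ A(x_i,y_i)=1\ \text{for all } i\Bigr\}\subset\mathbb R^2,$$ and let $H$ be the Hausdorff measure on $\mathbb S_A$ (with the Euclidean metric) in dimension $\ln D/\ln N$, normalized to total mass $1$. Let $\partial\mathcal B_D$ be the space of infinite paths $e=(e_1,e_2,\dots)$, $s(e_i)=r(e_{i+1})$, of the Bratteli diagram of the $D\times D$ matrix with all entries $1$ (vertices $0,\dots,D-1$ at every level, one edge with range $v$ and source $w$ between consecutive levels for every pair $(v,w)$), with the topology and Borel structure generated by the cylinder sets $[\gamma]$ of finite paths $\gamma$ starting at level $0$. Then $\mathbb S_A$ has Hausdorff dimension $\ln D/\ln N$; there is a unique Borel measure $M$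 on $\partial\mathcal B_D$ with $M[\gamma]=D^{-|\gamma|-1}$ for every finite path $\gamma$ of length $|\gamma|\ge 0$ (namely the one under which the vertices $r(e_1),r(e_2),\dots$ are independent and uniformly distributed); and the map $$\Upsilon:\partial\mathcal B_D\to\mathbb S_A,\qquad \Upsilon\bigl((e_i)_{i\ge1}\bigr)=\Bigl(\sum_{i\ge1}\frac{a_{r(e_i)}}{N^i},\ \sum_{i\ge1}\frac{b_{r(e_i)}}{N^i}\Bigr)$$ is an isomorphism of the measure spaces $(\partial\mathcal B_D,M)$ and $(\mathbb S_A,H)$: it is Borel, $\Upsilon_*M=H$, and it restricts to a bimeasurable bijection between Borel sets of full measure. Moreover, write paths as vertex sequences and put $\sigma_i(v_0v_1\dots)=(iv_0v_1\dots)$, $\sigma(v_0v_1\dots)=(v_1v_2\dots)$ on $\partial\mathcal B_D$, and $$\tau_i(x,y)=\Bigl(\frac{x+a_i}N,\frac{y+b_i}N\Bigr),\qquad \tau(x,y)=\Bigl(N\Bigl(x-\frac{x_1}N\Bigr),N\Bigl(y-\frac{y_1}N\Bigr)\Bigr)$$ on $\mathbb S_A$, where $(x_1,y_1)$ is the first digit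 pair of an admissible expansion of $(x,y)$ (any fixed choice of expansions being allowed for the points that have several). Then $(\sigma_i)_{0\le i<D}$ with coding map $\sigma$, and $(\tau_i)_{0\le i<D}$ with coding map $\tau$, are semibranching function systems on $(\partial\mathcal B_D,M)$ and $(\mathbb S_A,H)$. Here $(\sigma_i)$ with coding map $\sigma$ is a semibranching function system on $(X,\mu)$ if the $\sigma_i$ are $\mu$-measurable self-maps of $X$, the sets $R_{[i]}=\sigma_i(X)$ cover $X$ up to a $\mu$-null set and have $\mu$-null pairwise intersections, $\mu\circ\sigma_i$ (that is, $B\mapsto\mu(\sigma_i(B))$) is a measure with $\mu\circ\sigma_i\ll\mu$ and $\frac{d(\mu\circ\sigma_i)}{d\mu}>0$ $\mu$-a.e., and $\sigma\circ\sigma_i=\mathrm{id}$ $\mu$-a.e. Let $S_i$ on $L^2(\partial\mathcal B_D,M)$ and $T_i$ on $L^2(\mathbb S_A,H)$ be the operators associated with these two systems by the formula $$\xi\ \mapsto\ \chi_{R_{[i]}}(x)\Bigl(\frac{d(\mu\circ\sigma_i)}{d\mu}(\sigma(x))\Bigr)^{-1/2}\xi(\sigma(x)).$$ They are well-defined bounded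 operators, and $(S_i)$ and $(T_i)$ each satisfy the Cuntz relations $V_j^*V_i=\delta_{ij}I$, $\sum_{i=0}^{D-1}V_iV_i^*=I$, that is, they give representations of $\mathcal O_D$. The map $U\xi=\xi\circ\Upsilon$ is a unitary from $L^2(\mathbb S_A,H)$ onto $L^2(\partial\mathcal B_D,M)$, and $U\,T_i=S_i\,U$ for all $0\le i<D$. -/

import Mathlib

open MeasureTheory
open scoped ENNReal

namespace SierpinskiCuntz

/-! ### Bratteli diagrams and their infinite path spaces -/

/-- A Bratteli diagram: vertex sets `V 0, V 1, …` and, for every `n`, a set `E n` of edges between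
the levels `n` and `n + 1`, with range in `V n` and source in `V (n + 1)`. -/
structure BratteliDiagram where
  V : ℕ → Type
  E : ℕ → Type
  r : ∀ {n : ℕ}, E n → V n
  s : ∀ {n : ℕ}, E n → V (n + 1)

/-- Infinite paths `e₀ e₁ e₂ …` with `s (eₙ) = r (eₙ₊₁)`. -/
def BratteliDiagram.InfinitePath (B : BratteliDiagram) : Type :=
  {e : ∀ n, B.E n // ∀ n, B.s (e n) = B.r (e (n + 1))}

/-- Finite paths of length `n`, starting at level `0`: a vertex of level `0` if `n = 0`, otherwise
a string of `n` composable edges. -/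
def BratteliDiagram.FinitePath (B : BratteliDiagram) : ℕ → Type
  | 0 => B.V 0
  | n + 1 => {e : ∀ i : Fin (n + 1), B.E i //
      ∀ i : Fin n, B.s (e i.castSucc) = B.r (e i.succ)}

/-- The cylinder set `[γ]` of infinite paths with initial segment `γ`. -/
def BratteliDiagram.cylinder (B : BratteliDiagram) :
    (n : ℕ) → B.FinitePath n → Set B.InfinitePath
  | 0, v => {e | B.r (e.1 0) = v}
  | n + 1, γ => {e | ∀ i : Fin (n + 1), e.1 i = γ.1 i}

/-- The topology generated by the cylinder sets. -/
instance (B : BratteliDiagram) : TopologicalSpace B.InfinitePath :=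
  TopologicalSpace.generateFrom {U | ∃ (n : ℕ) (γ : B.FinitePath n), U = B.cylinder n γ}

instance (B : BratteliDiagram) : MeasurableSpace B.InfinitePath :=
  borel B.InfinitePath

instance (B : BratteliDiagram) : BorelSpace B.InfinitePath :=
  ⟨rfl⟩

/-- The Bratteli diagram of the `D × D` matrix with all entries `1`: every level has the vertices
`0, …, D - 1`, and there is exactly one edge `(v, w)` with range `v` and source `w`. -/
def fullDiagram (D : ℕ) : BratteliDiagram where
  V := fun _ => Fin D
  E := fun _ => Fin D × Fin D
  r := fun e => e.1
  s := fun e => e.2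

/-- The infinite path space of the full diagram on `D` vertices. -/
abbrev FullPath (D : ℕ) : Type := (fullDiagram D).InfinitePath

/-- The infinite path through the vertices `v₀, v₁, v₂, …`. -/
def pathOfVertices {D : ℕ} (v : ℕ → Fin D) : FullPath D :=
  ⟨fun n => (v n, v (n + 1)), fun _ => rfl⟩

/-- The measure `M` on infinite paths: the vertices passed through are independent and uniformly
distributed. -/
noncomputable def pathMeasure (D : ℕ) : Measure (FullPath D) :=
  (Measure.infinitePi fun _ : ℕ => ProbabilityTheory.uniformOn (Set.univ : Set (Fin D))).map
    pathOfVertices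

/-- The map `v₀ v₁ v₂ … ↦ i v₀ v₁ v₂ …`, in terms of edges. -/
def pathPrepend {D : ℕ} (i : Fin D) (e : FullPath D) : FullPath D :=
  ⟨fun n => match n with
    | 0 => (i, (e.1 0).1)
    | n + 1 => e.1 n,
   fun n => match n with
    | 0 => rfl
    | n + 1 => e.2 n⟩

/-- The shift `v₀ v₁ v₂ … ↦ v₁ v₂ …`, in terms of edges. -/
def pathShift {D : ℕ} (e : FullPath D) : FullPath D :=
  ⟨fun n => e.1 (n + 1), fun n => e.2 (n + 1)⟩

/-! ### The Sierpinski-type fractal -/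

abbrev Plane : Type := EuclideanSpace ℝ (Fin 2)

/-- The positions of the entries `1` of `A`, ordered lexicographically. -/
abbrev Symbols {N : ℕ} (A : Matrix (Fin N) (Fin N) ℕ) : Type :=
  {p : Fin N ×ₗ Fin N // A (ofLex p).1 (ofLex p).2 = 1}

/-- Row index of a symbol. -/
def Symbols.row {N : ℕ} {A : Matrix (Fin N) (Fin N) ℕ} (p : Symbols A) : Fin N := (ofLex p.1).1

/-- Column index of a symbol. -/
def Symbols.col {N : ℕ} {A : Matrix (Fin N) (Fin N) ℕ} (p : Symbols A) : Fin N := (ofLex p.1).2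

/-- The point `(∑ xᵢ / N ^ i, ∑ yᵢ / N ^ i)` with `i = 1, 2, …`; digits are indexed from `0` here. -/
noncomputable def digitPoint {N : ℕ} (x y : ℕ → Fin N) : Plane :=
  !₂[∑' i : ℕ, ((x i : ℕ) : ℝ) / (N : ℝ) ^ (i + 1), ∑' i : ℕ, ((y i : ℕ) : ℝ) / (N : ℝ) ^ (i + 1)]

/-- The fractal `S_A`. -/
def fractal {N : ℕ} (A : Matrix (Fin N) (Fin N) ℕ) : Set Plane :=
  {p | ∃ x y : ℕ → Fin N, (∀ i, A (x i) (y i) = 1) ∧ p = digitPoint x y}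

/-- Hausdorff measure on the metric space `S_A`, in dimension `log D / log N`, normalized to have
total mass `1`. -/
noncomputable def fractalMeasure {N : ℕ} (A : Matrix (Fin N) (Fin N) ℕ) (D : ℕ) :
    Measure (fractal A) :=
  (Measure.hausdorffMeasure (Real.log D / Real.log N) (Set.univ : Set (fractal A)))⁻¹ •
    Measure.hausdorffMeasure (Real.log D / Real.log N)

theorem summable_digits {N : ℕ} (x : ℕ → Fin N) :
    Summable fun i : ℕ => ((x i : ℕ) : ℝ) / (N : ℝ) ^ (i + 1) := by
  have hpos : 0 < N := (Nat.zero_le _).trans_lt (x 0).isLt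
  rcases Nat.lt_or_ge 1 N with h | h
  · have hN : (1 : ℝ) < N := by exact_mod_cast h
    have hg : Summable fun i : ℕ => ((N : ℝ)⁻¹) ^ i :=
      summable_geometric_of_lt_one (by positivity) (inv_lt_one_of_one_lt₀ hN)
    refine Summable.of_nonneg_of_le (fun i => by positivity) (fun i => ?_) hg
    have hx : ((x i : ℕ) : ℝ) ≤ N := by exact_mod_cast (x i).isLt.le
    rw [inv_pow, div_le_iff₀ (by positivity), pow_succ, inv_mul_cancel_left₀ (by positivity)]
    exact hx
  · obtain rfl : N = 1 := by omega
    have hz : (fun i : ℕ => ((x i : ℕ) : ℝ) / ((1 : ℕ) : ℝ) ^ (i + 1)) = fun _ => 0 := by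
      funext i
      simp
    rw [hz]
    exact summable_zero

theorem tsum_digits_cons {N : ℕ} (a : Fin N) (x : ℕ → Fin N) :
    ∑' i : ℕ, (((Nat.casesOn i a x : Fin N) : ℕ) : ℝ) / (N : ℝ) ^ (i + 1) =
      (∑' i : ℕ, ((x i : ℕ) : ℝ) / (N : ℝ) ^ (i + 1)) / N + (a : ℕ) / N := by
  rw [(summable_digits fun i => (Nat.casesOn i a x : Fin N)).tsum_eq_zero_add, ← tsum_div_const]
  simp only [zero_add, pow_one]
  rw [add_comm]
  congr 1
  refine tsum_congr fun i => ?_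
  rw [pow_succ (N : ℝ) (i + 1), div_div]

/-- The similarity `τ_j (x, y) = (x / N + a_j / N, y / N + b_j / N)` for the symbol
`j = (a_j, b_j)`, as a self-map of `S_A`. -/
noncomputable def tauMap {N : ℕ} {A : Matrix (Fin N) (Fin N) ℕ} (j : Symbols A)
    (p : fractal A) : fractal A :=
  ⟨!₂[p.1 0 / N + (j.row : ℕ) / N, p.1 1 / N + (j.col : ℕ) / N], by
    obtain ⟨p, x, y, hA, rfl⟩ := p
    refine ⟨fun i => Nat.casesOn i j.row x, fun i => Nat.casesOn i j.col y, ?_, ?_⟩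
    · rintro (_ | i)
      · exact j.2
      · exact hA i
    · simp [digitPoint, tsum_digits_cons]⟩

/-- `τ` is the coding map `(x, y) ↦ (N (x - x₁ / N), N (y - y₁ / N))`, where `(x₁, y₁)` is the first
digit pair of an admissible expansion of `(x, y)`. For points with several admissible expansions
any one of them may be used. -/
def IsCodingMap {N : ℕ} (A : Matrix (Fin N) (Fin N) ℕ) (τ : fractal A → fractal A) : Prop :=
  ∀ p : fractal A, ∃ x y : ℕ → Fin N, (∀ i, A (x i) (y i) = 1) ∧ p.1 = digitPoint x y ∧
    (τ p).1 = !₂[N * (p.1 0 - (x 0 : ℕ) / N), N * (p.1 1 - (y 0 : ℕ) / N)]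

/-! ### The map `Υ = Φ ∘ Θ` -/

/-- `Θ` sends a path to the sequence of symbols labelled by the vertices it passes through. -/
def thetaMap {N D : ℕ} {A : Matrix (Fin N) (Fin N) ℕ} (lab : Fin D → Symbols A)
    (e : FullPath D) : ℕ → Symbols A :=
  fun n => lab ((fullDiagram D).r (e.1 n))

/-- `Φ` sends a sequence of symbols to the point of `S_A` with these digits. -/
noncomputable def phiMap {N : ℕ} {A : Matrix (Fin N) (Fin N) ℕ} (c : ℕ → Symbols A) : fractal A :=
  ⟨digitPoint (fun i => (c i).row) (fun i => (c i).col), _, _, fun i => (c i).2, rfl⟩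

/-- `Υ = Φ ∘ Θ`. -/
noncomputable def upsilon {N D : ℕ} {A : Matrix (Fin N) (Fin N) ℕ} (lab : Fin D → Symbols A) :
    FullPath D → fractal A :=
  phiMap ∘ thetaMap lab

/-- `f` is an isomorphism of measure spaces: it preserves the measures and restricts to a
bimeasurable bijection between measurable sets of full measure. -/
def IsMeasureIso {X Y : Type*} [MeasurableSpace X] [MeasurableSpace Y]
    (μ : Measure X) (ν : Measure Y) (f : X → Y) : Prop :=
  MeasurePreserving f μ ν ∧
    ∃ (X₀ : Set X) (Y₀ : Set Y), MeasurableSet X₀ ∧ MeasurableSet Y₀ ∧ μ X₀ᶜ = 0 ∧ ν Y₀ᶜ = 0 ∧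
      ∃ g : X₀ ≃ᵐ Y₀, ∀ x : X₀, (g x : Y) = f x

/-! ### Semibranching function systems and representations of the Cuntz algebra -/

/-- A semibranching function system `(σ_i)` with coding map `σ`. The measure `μ ∘ σ_i`, that is
`B ↦ μ (σ_i (B))`, is `μ.comap (σ_i)`. -/
structure IsSemibranching {X : Type*} [MeasurableSpace X] {D : ℕ} (μ : Measure X)
    (σi : Fin D → X → X) (σ : X → X) : Prop where
  measurable : ∀ i, AEMeasurable (σi i) μ
  cover : μ (⋃ i, Set.range (σi i))ᶜ = 0
  disjoint : ∀ i j, i ≠ j → μ (Set.range (σi i) ∩ Set.range (σi j)) = 0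
  comap_apply : ∀ i, ∀ B, MeasurableSet B → μ.comap (σi i) B = μ (σi i '' B)
  absolutelyContinuous : ∀ i, μ.comap (σi i) ≪ μ
  deriv_pos : ∀ i, ∀ᵐ x ∂μ, 0 < (μ.comap (σi i)).rnDeriv μ x
  coding : ∀ i, ∀ᵐ x ∂μ, σ (σi i x) = x

/-- The function `x ↦ χ_{σ_i(X)}(x) (d(μ ∘ σ_i)/dμ (σ x)) ^ (-1/2) ξ(σ x)`. -/
noncomputable def semibranchingFun {X : Type*} [MeasurableSpace X] (μ : Measure X)
    (σi σ : X → X) (ξ : X → ℂ) : X → ℂ :=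
  (Set.range σi).indicator fun x =>
    ((((μ.comap σi).rnDeriv μ (σ x)).toReal ^ (-(1 / 2 : ℝ)) : ℝ) : ℂ) * ξ (σ x)

/-- `(S_i)` is the family of operators on `L²(X, μ)` associated with the system `(σ_i)`, `σ`. -/
def IsSemibranchingRep {X : Type*} [MeasurableSpace X] {D : ℕ} (μ : Measure X)
    (σi : Fin D → X → X) (σ : X → X) (S : Fin D → (Lp ℂ 2 μ →L[ℂ] Lp ℂ 2 μ)) : Prop :=
  ∀ i, ∀ ξ : Lp ℂ 2 μ, (S i ξ : X → ℂ) =ᵐ[μ] semibranchingFun μ (σi i) σ ξ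

/-- The Cuntz relations `S_j^* S_i = δ_{ij}` and `∑ S_i S_i^* = 1`. By the universal property of
`O_D`, such a family is the same thing as a (unital) representation of `O_D`. -/
def IsCuntzFamily {H : Type*} [NormedAddCommGroup H] [InnerProductSpace ℂ H] [CompleteSpace H]
    {D : ℕ} (S : Fin D → (H →L[ℂ] H)) : Prop :=
  (∀ i j, (ContinuousLinearMap.adjoint (S j)).comp (S i) =
      if i = j then ContinuousLinearMap.id ℂ H else 0) ∧
    ∑ i, (S i).comp (ContinuousLinearMap.adjoint (S i)) = ContinuousLinearMap.id ℂ H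

end SierpinskiCuntz

/-! A path is the same thing as its vertex sequence, so the path space is the Cantor space of
sequences in D letters. `pathMeasure` is the only measure giving mass D^(-n) to the cylinders fixing
n vertices (`eq_pathMeasure`). On this side the system is explicit: prepending a letter scales the
measure by 1/D, the derivative is the constant 1/D, and the Cuntz relations are a direct computation
(`exists_pathRep`).

On the fractal side `upsilon` is a continuous surjection turning `pathPrepend i` into the similarity
`tauMap (lab i)` of ratio 1/N (`upsilon_pathPrepend`). Put s = log D / log N, so N^s = D. Covering
by the D^n cylinder images shows that the s-dimensional Hausdorff measure is finite. A mass
distribution argument with the pushforward of `pathMeasure` shows that it is positive: a set of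
diameter at most N^(-n) meets at most 25 cells of the grid of first n digits. This gives the
dimension.

The normalized measure H is then scaled by exactly 1/D under each similarity. The D images of the
fractal have total mass 1 and cover it, so they overlap in null sets (`fractalMeasure_range_inter`),
and by self-similarity almost every point has a single code. Hence `upsilon` has a measurable
section s off a null set (`exists_section_upsilon`). The scaling of H gives s_*H the cylinder masses
of M, so s_*H = M and therefore `upsilon` carries M to H.

The operators on the fractal are the conjugates of the path operators by the unitary ξ ↦ ξ ∘ Υ. The
Cuntz relations and the intertwining are then automatic; what must be checked is that these
conjugates are given by the semibranching formula for τ. This holds because τ agrees with the shift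
at every uniquely coded point (`codingMap_upsilon`). -/

namespace SierpinskiCuntz

/-! ### The path space as a space of vertex sequences -/

section PathSpace

variable {D : ℕ}

/-- The sequence of vertices visited by a path. -/
def vertices (e : FullPath D) (n : ℕ) : Fin D := (e.1 n).1

theorem vertices_pathOfVertices (v : ℕ → Fin D) : vertices (pathOfVertices v) = v := rfl

theorem edge_eq (e : FullPath D) (n : ℕ) : e.1 n = (vertices e n, vertices e (n + 1)) :=
  Prod.ext rfl (e.2 n)

theorem pathOfVertices_vertices (e : FullPath D) : pathOfVertices (vertices e) = e :=
  Subtype.ext (funext fun n => (edge_eq e n).symm)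

theorem vertices_injective : Function.Injective (vertices : FullPath D → ℕ → Fin D) :=
  Function.LeftInverse.injective pathOfVertices_vertices

theorem vertices_pathPrepend_zero (i : Fin D) (e : FullPath D) :
    vertices (pathPrepend i e) 0 = i := rfl

theorem pathShift_pathPrepend (i : Fin D) (e : FullPath D) : pathShift (pathPrepend i e) = e := rfl

theorem pathPrepend_injective (i : Fin D) : Function.Injective (pathPrepend i) :=
  Function.LeftInverse.injective (pathShift_pathPrepend i)

theorem pathPrepend_pathShift (e : FullPath D) : pathPrepend (vertices e 0) (pathShift e) = e :=
  vertices_injective <| funext fun n => by cases n <;> rfl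

theorem range_pathPrepend (i : Fin D) : Set.range (pathPrepend i) = {e | vertices e 0 = i} := by
  ext e
  constructor
  · rintro ⟨e, rfl⟩
    rfl
  · rintro rfl
    exact ⟨_, pathPrepend_pathShift e⟩

/-! ### Cylinder sets and the product topology -/

/-- The initial segment of length `n` of a path. -/
def initialSegment (e : FullPath D) : (n : ℕ) → (fullDiagram D).FinitePath n
  | 0 => (fullDiagram D).r (e.1 0)
  | n + 1 => ⟨fun i : Fin (n + 1) => e.1 i, fun i : Fin n => e.2 i⟩

/-- Composable edges share a vertex, so n edges amount to n + 1 vertices; a path of length 0 already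
fixes one vertex. This shift by one is the source of the exponent n + 1 in the mass of a cylinder.
-/
theorem mem_cylinder_initialSegment (e f : FullPath D) (n : ℕ) :
    f ∈ (fullDiagram D).cylinder n (initialSegment e n) ↔ ∀ i ≤ n, vertices f i = vertices e i := by
  cases n with
  | zero =>
    simp only [Nat.le_zero, forall_eq]
    rfl
  | succ n =>
    change (∀ i : Fin (n + 1), f.1 i = e.1 i) ↔ _
    constructor
    · intro h i hi
      rcases Nat.lt_or_ge i (n + 1) with h' | h'
      · exact congrArg Prod.fst (h ⟨i, h'⟩)
      · obtain rfl : i = n + 1 := le_antisymm hi h'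
        have := congrArg Prod.snd (h (Fin.last n))
        rwa [edge_eq, edge_eq] at this
    · intro h i
      rw [edge_eq, edge_eq, h i (by omega), h (i + 1) (by omega)]

theorem exists_initialSegment_eq (n : ℕ) (γ : (fullDiagram D).FinitePath n) :
    ∃ e : FullPath D, initialSegment e n = γ := by
  cases n with
  | zero => exact ⟨pathOfVertices fun _ => γ, rfl⟩
  | succ n =>
    -- Read off the ranges of the edges, then stay forever at the source of the last edge.
    refine ⟨pathOfVertices fun k => if h : k < n + 1 then (γ.1 ⟨k, h⟩).1
      else (γ.1 (Fin.last n)).2, Subtype.ext <| funext fun i => Prod.ext ?_ ?_⟩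
    · change dite _ _ _ = _
      rw [dif_pos i.2]
    · change dite _ _ _ = _
      rcases Fin.eq_castSucc_or_eq_last i with ⟨j, rfl⟩ | rfl
      · rw [dif_pos (by simp)]
        exact (γ.2 j).symm
      · rw [dif_neg (by simp)]

theorem cylinder_eq_preimage (e : FullPath D) (n : ℕ) :
    (fullDiagram D).cylinder n (initialSegment e n) =
      vertices ⁻¹' PiNat.cylinder (vertices e) (n + 1) := by
  ext f
  rw [mem_cylinder_initialSegment, Set.mem_preimage, PiNat.mem_cylinder_iff]
  simp only [Nat.lt_succ_iff]

theorem continuous_vertices : Continuous (vertices : FullPath D → ℕ → Fin D) := by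
  refine continuous_pi fun n => continuous_discrete_rng.2 fun k => ?_
  have h : (fun e : FullPath D => vertices e n) ⁻¹' {k} =
      ⋃ e ∈ {e : FullPath D | vertices e n = k},
        (fullDiagram D).cylinder n (initialSegment e n) := by
    ext f
    simp only [Set.mem_preimage, Set.mem_singleton_iff, Set.mem_ofPred_eq, Set.mem_iUnion,
      mem_cylinder_initialSegment, exists_prop]
    exact ⟨fun h => ⟨f, h, fun _ _ => rfl⟩, fun ⟨e, he, h⟩ => (h n le_rfl).trans he⟩
  rw [h]
  exact isOpen_biUnion fun e _ => TopologicalSpace.isOpen_generateFrom_of_mem ⟨n, _, rfl⟩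

theorem continuous_pathOfVertices : Continuous (pathOfVertices : (ℕ → Fin D) → FullPath D) := by
  refine continuous_generateFrom_iff.2 ?_
  rintro _ ⟨n, γ, rfl⟩
  obtain ⟨e, rfl⟩ := exists_initialSegment_eq n γ
  rw [cylinder_eq_preimage]
  exact PiNat.isOpen_cylinder (fun _ : ℕ => Fin D) _ _

/-- The path space of the full diagram is the space of all vertex sequences. -/
def vertexHomeomorph (D : ℕ) : (ℕ → Fin D) ≃ₜ FullPath D where
  toFun := pathOfVertices
  invFun := vertices
  left_inv := vertices_pathOfVertices
  right_inv := pathOfVertices_vertices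
  continuous_toFun := continuous_pathOfVertices
  continuous_invFun := continuous_vertices

instance : CompactSpace (FullPath D) := (vertexHomeomorph D).compactSpace

instance : T2Space (FullPath D) := (vertexHomeomorph D).symm.isEmbedding.t2Space

instance : PolishSpace (FullPath D) :=
  have : PolishSpace (Fin D) := inferInstance
  (vertexHomeomorph D).symm.isClosedEmbedding.polishSpace

theorem continuous_vertex (n : ℕ) : Continuous fun e : FullPath D => vertices e n :=
  (continuous_apply n).comp continuous_vertices

theorem continuous_of_vertices {X : Type*} [TopologicalSpace X] {f : X → FullPath D}
    (h : ∀ n, Continuous fun x => vertices (f x) n) : Continuous f :=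
  (vertexHomeomorph D).symm.comp_continuous_iff.1 (continuous_pi h)

theorem continuous_pathShift : Continuous (pathShift : FullPath D → FullPath D) :=
  continuous_of_vertices fun n => continuous_vertex (n + 1)

theorem continuous_pathPrepend (i : Fin D) : Continuous (pathPrepend i) :=
  continuous_of_vertices fun n => by
    cases n with
    | zero => exact continuous_const
    | succ n => exact continuous_vertex n

theorem measurableEmbedding_pathPrepend (i : Fin D) : MeasurableEmbedding (pathPrepend i) :=
  ((continuous_pathPrepend i).isClosedEmbedding (pathPrepend_injective i)).measurableEmbedding

theorem measurableSet_range_pathPrepend (i : Fin D) :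
    MeasurableSet (Set.range (pathPrepend i)) :=
  (measurableEmbedding_pathPrepend i).measurableSet_range

/-! ### The measure on the path space -/

/-- The set of paths visiting the same first `n` vertices as `e`. -/
def vertexCylinder (e : FullPath D) (n : ℕ) : Set (FullPath D) :=
  {f | ∀ i < n, vertices f i = vertices e i}

theorem vertexCylinder_eq_preimage (e : FullPath D) (n : ℕ) :
    vertexCylinder e n = vertices ⁻¹' PiNat.cylinder (vertices e) n :=
  Set.ext fun _ => PiNat.mem_cylinder_iff.symm

theorem vertexCylinder_zero (e : FullPath D) : vertexCylinder e 0 = Set.univ :=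
  Set.eq_univ_of_forall fun _ _ hi => absurd hi (Nat.not_lt_zero _)

theorem isClopen_vertexCylinder (e : FullPath D) (n : ℕ) : IsClopen (vertexCylinder e n) := by
  have h : vertexCylinder e n =
      ⋂ i ∈ Finset.range n, (fun f => vertices f i) ⁻¹' {vertices e i} := by
    ext f
    simp [vertexCylinder]
  rw [h]
  exact isClopen_biInter_finset fun i _ => (isClopen_discrete _).preimage (continuous_vertex i)

theorem measurableSet_vertexCylinder (e : FullPath D) (n : ℕ) :
    MeasurableSet (vertexCylinder e n) :=
  (isClopen_vertexCylinder e n).isOpen.measurableSet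

theorem cylinder_initialSegment (e : FullPath D) (n : ℕ) :
    (fullDiagram D).cylinder n (initialSegment e n) = vertexCylinder e (n + 1) := by
  rw [cylinder_eq_preimage, vertexCylinder_eq_preimage]

/-- If two cylinders meet in g, both are cylinders around g, and their intersection is the longer of
the two. -/
theorem isPiSystem_vertexCylinder :
    IsPiSystem {s : Set (FullPath D) | ∃ e n, s = vertexCylinder e n} := by
  rintro _ ⟨e, n, rfl⟩ _ ⟨f, m, rfl⟩ ⟨g, hge, hgf⟩
  refine ⟨g, max n m, Set.ext fun x => ⟨fun ⟨h1, h2⟩ i hi => ?_, fun h => ⟨fun i hi => ?_,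
    fun i hi => ?_⟩⟩⟩
  · rcases lt_max_iff.1 hi with h | h
    · exact (h1 i h).trans (hge i h).symm
    · exact (h2 i h).trans (hgf i h).symm
  · exact (h i (lt_max_of_lt_left hi)).trans (hge i hi)
  · exact (h i (lt_max_of_lt_right hi)).trans (hgf i hi)

theorem borel_eq_generateFrom_vertexCylinder :
    borel (FullPath D) =
      MeasurableSpace.generateFrom {s : Set (FullPath D) | ∃ e n, s = vertexCylinder e n} := by
  refine TopologicalSpace.IsTopologicalBasis.borel_eq_generateFrom ?_
  have h := (PiNat.isTopologicalBasis_cylinders fun _ : ℕ => Fin D).isInducing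
    (vertexHomeomorph D).symm.isInducing
  convert h using 1
  ext s
  constructor
  · rintro ⟨e, n, rfl⟩
    exact ⟨PiNat.cylinder (vertices e) n, ⟨vertices e, n, rfl⟩, (vertexCylinder_eq_preimage e n).symm⟩
  · rintro ⟨_, ⟨v, n, rfl⟩, rfl⟩
    exact ⟨pathOfVertices v, n, (vertexCylinder_eq_preimage (pathOfVertices v) n).symm⟩

theorem preimage_pathPrepend_vertexCylinder (i : Fin D) (e : FullPath D) (n : ℕ) :
    pathPrepend i ⁻¹' vertexCylinder e (n + 1) =
      if i = vertices e 0 then vertexCylinder (pathShift e) n else ∅ := by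
  ext f
  have h : f ∈ pathPrepend i ⁻¹' vertexCylinder e (n + 1) ↔
      i = vertices e 0 ∧ f ∈ vertexCylinder (pathShift e) n := by
    refine ⟨fun h => ⟨h 0 n.succ_pos, fun k hk => h (k + 1) (Nat.succ_lt_succ hk)⟩, ?_⟩
    rintro ⟨rfl, h⟩ (_ | k) hk
    · rfl
    · exact h k (Nat.lt_of_succ_lt_succ hk)
  rw [h]
  split_ifs with hi <;> simp [hi]

variable [NeZero D]

instance : Nonempty (FullPath D) := ⟨pathOfVertices fun _ => 0⟩

instance : IsProbabilityMeasure (pathMeasure D) :=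
  Measure.isProbabilityMeasure_map continuous_pathOfVertices.measurable.aemeasurable

theorem pathMeasure_vertexCylinder (e : FullPath D) (n : ℕ) :
    pathMeasure D (vertexCylinder e n) = ((D : ℝ≥0∞) ^ n)⁻¹ := by
  rw [pathMeasure, Measure.map_apply continuous_pathOfVertices.measurable
    (measurableSet_vertexCylinder e n)]
  have h : pathOfVertices ⁻¹' vertexCylinder e n =
      ((Finset.range n : Finset ℕ) : Set ℕ).pi fun i => {vertices e i} := by
    ext v
    simp [vertexCylinder, vertices_pathOfVertices, Set.mem_pi]
  rw [h, Measure.infinitePi_pi _ fun _ _ => measurableSet_singleton _]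
  simp [ProbabilityTheory.uniformOn_univ, ENNReal.inv_pow]

theorem eq_pathMeasure {μ : Measure (FullPath D)}
    (h : ∀ e n, μ (vertexCylinder e n) = ((D : ℝ≥0∞) ^ n)⁻¹) : μ = pathMeasure D := by
  obtain ⟨e⟩ := (inferInstance : Nonempty (FullPath D))
  refine (ext_of_generate_finite _ borel_eq_generateFrom_vertexCylinder isPiSystem_vertexCylinder
    ?_ ?_).symm
  · rintro _ ⟨e, n, rfl⟩
    rw [h, pathMeasure_vertexCylinder]
  · rw [← vertexCylinder_zero e, h, pathMeasure_vertexCylinder]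

/-- The cylinders of finite paths fix at least one vertex, so the total mass, the case n = 0 of
`eq_pathMeasure`, is recovered by adding up the D cylinders that fix the first vertex. -/
theorem forall_cylinder_iff_eq_pathMeasure (μ : Measure (FullPath D)) :
    (∀ (n : ℕ) (γ : (fullDiagram D).FinitePath n),
      μ ((fullDiagram D).cylinder n γ) = ((D : ℝ≥0∞) ^ (n + 1))⁻¹) ↔ μ = pathMeasure D := by
  constructor
  · intro h
    have hs : ∀ e n, μ (vertexCylinder e (n + 1)) = ((D : ℝ≥0∞) ^ (n + 1))⁻¹ := fun e n => by
      rw [← cylinder_initialSegment, h]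
    refine eq_pathMeasure fun e n => ?_
    cases n with
    | succ n => exact hs e n
    | zero =>
      have hu : (Set.univ : Set (FullPath D)) =
          ⋃ k : Fin D, vertexCylinder (pathOfVertices fun _ => k) 1 :=
        (Set.eq_univ_of_forall fun f => Set.mem_iUnion.2 ⟨vertices f 0, fun i hi => by
          rw [Nat.lt_one_iff.1 hi]; rfl⟩).symm
      rw [vertexCylinder_zero, hu, measure_iUnion]
      · simp only [hs, zero_add, pow_one, tsum_fintype, Finset.sum_const, Finset.card_univ,
          Fintype.card_fin, nsmul_eq_mul, pow_zero, inv_one]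
        exact ENNReal.mul_inv_cancel (by simp [NeZero.ne D]) (by simp)
      · intro k l hkl
        refine Set.disjoint_left.2 fun f hk hl => hkl ?_
        exact (hk 0 one_pos).symm.trans (hl 0 one_pos)
      · exact fun k => measurableSet_vertexCylinder _ _
  · rintro rfl n γ
    obtain ⟨e, rfl⟩ := exists_initialSegment_eq n γ
    rw [cylinder_initialSegment, pathMeasure_vertexCylinder]

/-- The measure on the path space is self-similar. -/
theorem pathMeasure_eq_sum :
    pathMeasure D = (D : ℝ≥0∞)⁻¹ • ∑ i : Fin D, (pathMeasure D).map (pathPrepend i) := by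
  have hD : (D : ℝ≥0∞) ≠ 0 := by simp [NeZero.ne D]
  refine (eq_pathMeasure fun e n => ?_).symm
  simp only [Measure.smul_apply, Measure.finsetSum_apply, smul_eq_mul]
  have hm : ∀ i : Fin D, (pathMeasure D).map (pathPrepend i) (vertexCylinder e n) =
      pathMeasure D (pathPrepend i ⁻¹' vertexCylinder e n) := fun i =>
    Measure.map_apply (continuous_pathPrepend i).measurable
      (measurableSet_vertexCylinder e n)
  simp only [hm]
  cases n with
  | zero => simp [vertexCylinder_zero, ENNReal.inv_mul_cancel hD]
  | succ n =>
    simp only [preimage_pathPrepend_vertexCylinder, apply_ite (pathMeasure D), measure_empty,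
      Finset.sum_ite_eq', Finset.mem_univ, if_true, pathMeasure_vertexCylinder]
    rw [pow_succ', ENNReal.mul_inv (by simp [hD]) (by simp)]

theorem map_pathPrepend_le (i : Fin D) :
    (pathMeasure D).map (pathPrepend i) ≤ (D : ℝ≥0∞) • pathMeasure D := by
  have hD : (D : ℝ≥0∞) ≠ 0 := by simp [NeZero.ne D]
  conv_rhs => rw [pathMeasure_eq_sum, smul_smul, ENNReal.mul_inv_cancel hD (by simp), one_smul]
  exact Finset.single_le_sum (f := fun j => (pathMeasure D).map (pathPrepend j))
    (fun j _ => Measure.zero_le _) (Finset.mem_univ i)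

/-- In the self-similar decomposition of the measure, the shift undoes every prepending map, so each
of the D terms contributes the same mass. -/
theorem measurePreserving_pathShift :
    MeasurePreserving pathShift (pathMeasure D) (pathMeasure D) := by
  have hD : (D : ℝ≥0∞) ≠ 0 := by simp [NeZero.ne D]
  refine ⟨continuous_pathShift.measurable, ?_⟩
  ext s hs
  rw [Measure.map_apply continuous_pathShift.measurable hs]
  conv_lhs => rw [pathMeasure_eq_sum]
  simp only [Measure.smul_apply, Measure.finsetSum_apply, smul_eq_mul]
  have hm : ∀ i : Fin D, (pathMeasure D).map (pathPrepend i) (pathShift ⁻¹' s) =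
      pathMeasure D s := fun i =>
    Measure.map_apply (continuous_pathPrepend i).measurable (continuous_pathShift.measurable hs)
  simp [hm, ← mul_assoc, ENNReal.inv_mul_cancel hD]

theorem pathMeasure_image_pathPrepend (i : Fin D) (s : Set (FullPath D)) (hs : MeasurableSet s) :
    pathMeasure D (pathPrepend i '' s) = (D : ℝ≥0∞)⁻¹ * pathMeasure D s := by
  have hs' := (measurableEmbedding_pathPrepend i).measurableSet_image.2 hs
  conv_lhs => rw [pathMeasure_eq_sum]
  simp only [Measure.smul_apply, Measure.finsetSum_apply, smul_eq_mul]
  rw [Finset.sum_eq_single i, Measure.map_apply (continuous_pathPrepend i).measurable hs',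
    (pathPrepend_injective i).preimage_image]
  · intro j _ hj
    rw [Measure.map_apply (continuous_pathPrepend j).measurable hs']
    convert measure_empty (μ := pathMeasure D)
    refine Set.eq_empty_of_forall_notMem ?_
    rintro e ⟨f, -, hf⟩
    exact hj (congrArg (fun e => vertices e 0) hf).symm
  · simp

theorem comap_pathPrepend (i : Fin D) :
    (pathMeasure D).comap (pathPrepend i) = (D : ℝ≥0∞)⁻¹ • pathMeasure D := by
  ext s hs
  rw [(measurableEmbedding_pathPrepend i).comap_apply, pathMeasure_image_pathPrepend i s hs]
  rfl

end PathSpace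

/-! ### Geometry of the fractal -/

section Geometry

variable {N D : ℕ} {A : Matrix (Fin N) (Fin N) ℕ}

theorem digitPoint_eq (x y : ℕ → Fin N) :
    digitPoint x y = !₂[Real.ofDigits x, Real.ofDigits y] := by
  simp only [digitPoint, Real.ofDigits, Real.ofDigitsTerm, div_eq_mul_inv]

theorem coe_upsilon (lab : Fin D ≃o Symbols A) (e : FullPath D) :
    (upsilon lab e : Plane) = !₂[Real.ofDigits fun n => (lab (vertices e n)).row,
      Real.ofDigits fun n => (lab (vertices e n)).col] :=
  digitPoint_eq _ _

theorem upsilon_pathPrepend (lab : Fin D ≃o Symbols A) (i : Fin D) (e : FullPath D) :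
    upsilon lab (pathPrepend i e) = tauMap (lab i) (upsilon lab e) := by
  have h (f : Symbols A → Fin N) :
      (∑' n : ℕ, ((f (lab (vertices (pathPrepend i e) n)) : ℕ) : ℝ) / (N : ℝ) ^ (n + 1)) =
        (∑' n : ℕ, ((f (lab (vertices e n)) : ℕ) : ℝ) / (N : ℝ) ^ (n + 1)) / N +
          (f (lab i) : ℕ) / N := by
    rw [← tsum_digits_cons]
    exact tsum_congr fun n => by cases n <;> rfl
  exact Subtype.ext (congrArg₂ (fun a b : ℝ => (!₂[a, b] : Plane)) (h Symbols.row) (h Symbols.col))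

theorem upsilon_surjective (lab : Fin D ≃o Symbols A) : Function.Surjective (upsilon lab) := by
  rintro ⟨_, x, y, hA, rfl⟩
  refine ⟨pathOfVertices fun n => lab.symm ⟨toLex (x n, y n), hA n⟩, Subtype.ext ?_⟩
  refine (coe_upsilon lab _).trans (Eq.trans ?_ (digitPoint_eq x y).symm)
  simp only [vertices_pathOfVertices, OrderIso.apply_symm_apply]
  rfl

theorem continuous_upsilon (lab : Fin D ≃o Symbols A) : Continuous (upsilon lab) := by
  have h (f : Symbols A → Fin N) :
      Continuous fun e : FullPath D => Real.ofDigits fun n => f (lab (vertices e n)) :=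
    Real.continuous_ofDigits.comp <| continuous_pi fun n =>
      (continuous_of_discreteTopology (f := fun k => f (lab k))).comp (continuous_vertex n)
  refine Continuous.subtype_mk ?_ _
  have := (PiLp.continuous_toLp 2 fun _ : Fin 2 => ℝ).comp
    (continuous_pi (f := fun (e : FullPath D) (k : Fin 2) =>
      (![Real.ofDigits fun n => (lab (vertices e n)).row,
        Real.ofDigits fun n => (lab (vertices e n)).col] : Fin 2 → ℝ) k) fun k => by
      fin_cases k
      · exact h Symbols.row
      · exact h Symbols.col)
  exact this.congr fun e => (coe_upsilon lab e).symm

theorem compactSpace_fractal (lab : Fin D ≃o Symbols A) : CompactSpace (fractal A) :=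
  ⟨(upsilon_surjective lab).range_eq ▸ isCompact_range (continuous_upsilon lab)⟩

/-! ### The similarities and the diameters of cylinder images -/

theorem dist_tauMap (j : Symbols A) (p q : fractal A) :
    dist (tauMap j p) (tauMap j q) = (N : ℝ)⁻¹ * dist p q := by
  have h (p : fractal A) : (tauMap j p : Plane) =
      (N : ℝ)⁻¹ • (p : Plane) + !₂[((j.row : ℕ) : ℝ) / N, ((j.col : ℕ) : ℝ) / N] := by
    ext k
    fin_cases k <;> simp [tauMap, div_eq_inv_mul]
  rw [Subtype.dist_eq, h, h, dist_add_right, dist_smul₀, Real.norm_of_nonneg (by positivity)]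
  rfl

theorem lipschitzWith_tauMap (j : Symbols A) : LipschitzWith (N : NNReal)⁻¹ (tauMap j) :=
  LipschitzWith.of_dist_le_mul fun p q => by
    rw [dist_tauMap]
    simp

theorem antilipschitzWith_tauMap (hN : 2 ≤ N) (j : Symbols A) :
    AntilipschitzWith (N : NNReal) (tauMap j) :=
  AntilipschitzWith.of_le_mul_dist fun p q => by
    have : (N : ℝ) ≠ 0 := by positivity
    rw [dist_tauMap]
    simp [this]

theorem measurableEmbedding_tauMap (hN : 2 ≤ N) (lab : Fin D ≃o Symbols A) (j : Symbols A) :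
    MeasurableEmbedding (tauMap j) :=
  have := compactSpace_fractal lab
  ((lipschitzWith_tauMap j).continuous.isClosedEmbedding
    (antilipschitzWith_tauMap hN j).injective).measurableEmbedding

theorem image_upsilon_vertexCylinder_succ (lab : Fin D ≃o Symbols A) (e : FullPath D) (n : ℕ) :
    upsilon lab '' vertexCylinder e (n + 1) =
      tauMap (lab (vertices e 0)) '' (upsilon lab '' vertexCylinder (pathShift e) n) := by
  have h : vertexCylinder e (n + 1) =
      pathPrepend (vertices e 0) '' vertexCylinder (pathShift e) n := by
    ext f
    constructor
    · intro h
      refine ⟨pathShift f, fun i hi => h (i + 1) (Nat.succ_lt_succ hi), ?_⟩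
      rw [← h 0 n.succ_pos, pathPrepend_pathShift]
    · rintro ⟨f, hf, rfl⟩ (_ | i) hi
      · rfl
      · exact hf i (Nat.lt_of_succ_lt_succ hi)
  rw [h, Set.image_image, Set.image_image]
  simp only [upsilon_pathPrepend]

theorem ediam_image_vertexCylinder_le (lab : Fin D ≃o Symbols A) (e : FullPath D) (n : ℕ) :
    Metric.ediam (upsilon lab '' vertexCylinder e n) ≤
      ((N : ℝ≥0∞)⁻¹) ^ n * Metric.ediam (Set.univ : Set (fractal A)) := by
  induction n generalizing e with
  | zero => simpa using Metric.ediam_mono (Set.subset_univ _)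
  | succ n ih =>
    rw [image_upsilon_vertexCylinder_succ]
    refine ((lipschitzWith_tauMap _).ediam_image_le _).trans ?_
    rw [pow_succ', mul_assoc]
    gcongr
    · have hN : N ≠ 0 := (Fin.pos (lab (vertices e 0)).row).ne'
      rw [ENNReal.coe_inv (by exact_mod_cast hN)]
      simp
    · exact ih _

/-! ### Finiteness and positivity of the Hausdorff measure -/

theorem natCast_rpow_dim (hN : 2 ≤ N) [NeZero D] :
    (N : ℝ≥0∞) ^ (Real.log D / Real.log N) = D := by
  have hN' : (0 : ℝ) < N := by positivity
  have hD : (0 : ℝ) < D := by exact_mod_cast Nat.pos_of_neZero D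
  rw [← ENNReal.ofReal_natCast, ENNReal.ofReal_rpow_of_pos hN', ← Real.logb,
    Real.rpow_logb hN' (by exact_mod_cast (by omega : N ≠ 1)) hD, ENNReal.ofReal_natCast]

theorem dim_nonneg (N D : ℕ) : 0 ≤ Real.log D / Real.log N :=
  div_nonneg (Real.log_natCast_nonneg D) (Real.log_natCast_nonneg N)

theorem inv_natCast_pow_rpow_dim (hN : 2 ≤ N) [NeZero D] (n : ℕ) :
    (((N : ℝ≥0∞)⁻¹) ^ n) ^ (Real.log D / Real.log N) = ((D : ℝ≥0∞)⁻¹) ^ n := by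
  rw [← ENNReal.rpow_natCast, ← ENNReal.rpow_mul, mul_comm, ENNReal.rpow_mul, ENNReal.inv_rpow,
    natCast_rpow_dim hN, ENNReal.rpow_natCast]

theorem tendsto_inv_natCast_pow (hN : 2 ≤ N) :
    Filter.Tendsto (fun n : ℕ => ((N : ℝ≥0∞)⁻¹) ^ n) Filter.atTop (nhds 0) :=
  ENNReal.tendsto_pow_atTop_nhds_zero_of_lt_one <|
    ENNReal.inv_lt_one.2 (by exact_mod_cast (by omega : 1 < N))

/-- The D^n cylinder images of level n have diameter at most C N^(-n), and D^n (C N^(-n))^s = C^s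
for every n, so the measure is at most C^s. -/
theorem hausdorffMeasure_univ_ne_top (hN : 2 ≤ N) [NeZero D] (lab : Fin D ≃o Symbols A) :
    Measure.hausdorffMeasure (Real.log D / Real.log N) (Set.univ : Set (fractal A)) ≠ ∞ := by
  have := compactSpace_fractal lab
  have hD : (D : ℝ≥0∞) ≠ 0 := by simp [NeZero.ne D]
  set s := Real.log D / Real.log N
  set C := Metric.ediam (Set.univ : Set (fractal A))
  have hC : C ≠ ∞ := isCompact_univ.isBounded.ediam_ne_top
  -- A path representing the word v; the padding by 0 does not affect its cylinder of length n.
  let w (n : ℕ) (v : Fin n → Fin D) : FullPath D :=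
    pathOfVertices fun k => if h : k < n then v ⟨k, h⟩ else 0
  have hr : Filter.Tendsto (fun n : ℕ => ((N : ℝ≥0∞)⁻¹) ^ n * C) Filter.atTop (nhds 0) := by
    simpa using ENNReal.Tendsto.mul_const (tendsto_inv_natCast_pow hN) (Or.inr hC)
  have key := Measure.hausdorffMeasure_le_liminf_sum s (Set.univ : Set (fractal A))
    (ι := fun n => Fin n → Fin D) _ hr (fun n v => upsilon lab '' vertexCylinder (w n v) n)
    (Filter.Eventually.of_forall fun n v => ediam_image_vertexCylinder_le lab _ n)
    (Filter.Eventually.of_forall fun n p _ => by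
      obtain ⟨e, rfl⟩ := upsilon_surjective lab p
      refine Set.mem_iUnion.2 ⟨fun k => vertices e k, e, fun k hk => ?_, rfl⟩
      change _ = dite _ _ _
      rw [dif_pos hk])
  refine ne_top_of_le_ne_top (ENNReal.rpow_ne_top_of_nonneg (dim_nonneg N D) hC)
    (key.trans (Filter.liminf_le_of_frequently_le' (Filter.Frequently.of_forall fun n => ?_)))
  calc ∑ v, Metric.ediam (upsilon lab '' vertexCylinder (w n v) n) ^ s
      ≤ ∑ v : Fin n → Fin D, (((N : ℝ≥0∞)⁻¹) ^ n * C) ^ s := by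
        gcongr with v
        exact ediam_image_vertexCylinder_le lab _ n
    _ = C ^ s := by
        rw [ENNReal.mul_rpow_of_nonneg _ _ (dim_nonneg N D), inv_natCast_pow_rpow_dim hN]
        simp only [Finset.sum_const, Finset.card_univ, Fintype.card_fun, Fintype.card_fin,
          nsmul_eq_mul, Nat.cast_pow]
        rw [← mul_assoc, ← mul_pow, ENNReal.mul_inv_cancel hD (by simp), one_pow, one_mul]

/-! ### Digit codes and the mass distribution bound -/

/-- The integer whose base `N` digits are `x 0, …, x (n - 1)`. -/
def digitCode (x : ℕ → Fin N) : ℕ → ℕ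
  | 0 => 0
  | n + 1 => N * digitCode x n + x n

/-- Quotient and remainder by N recover the shorter code and the last digit. -/
theorem eq_of_digitCode_eq {x y : ℕ → Fin N} {n : ℕ} (h : digitCode x n = digitCode y n) :
    ∀ k < n, x k = y k := by
  induction n with
  | zero => exact fun k hk => absurd hk (Nat.not_lt_zero k)
  | succ n ih =>
    have hN : 0 < N := Fin.pos (x 0)
    simp only [digitCode] at h
    have h1 := congrArg (· / N) h
    have h2 := congrArg (· % N) h
    simp only [Nat.mul_add_div hN, Nat.div_eq_of_lt (x n).isLt, Nat.div_eq_of_lt (y n).isLt,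
      add_zero, Nat.mul_add_mod, Nat.mod_eq_of_lt (x n).isLt, Nat.mod_eq_of_lt (y n).isLt] at h1 h2
    intro k hk
    rcases Nat.lt_succ_iff_lt_or_eq.1 hk with hk | rfl
    · exact ih h1 k hk
    · exact Fin.ext h2

theorem pow_mul_ofDigits (x : ℕ → Fin N) (n : ℕ) :
    (N : ℝ) ^ n * Real.ofDigits x = digitCode x n + Real.ofDigits fun k => x (k + n) := by
  have hN : (N : ℝ) ≠ 0 := by exact_mod_cast (Fin.pos (x 0)).ne'
  induction n with
  | zero => simp [digitCode]
  | succ n ih =>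
    rw [pow_succ', mul_assoc, ih, Real.ofDigits_eq_sum_add_ofDigits (fun k => x (k + n)) 1]
    simp only [digitCode, Finset.range_one, Finset.sum_singleton, Real.ofDigitsTerm, zero_add,
      pow_one, Nat.cast_add, Nat.cast_mul, add_assoc, add_comm 1 n]
    field_simp

/-- After multiplication by N^n the numbers differ by at most 1, and the codes are obtained by
removing tails in [0, 1]; so the codes differ by at most 2. The truncated subtraction at the left
end is harmless. -/
theorem digitCode_mem_Icc {x y : ℕ → Fin N} {n : ℕ}
    (h : |Real.ofDigits x - Real.ofDigits y| ≤ ((N : ℝ)⁻¹) ^ n) :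
    digitCode y n ∈ Finset.Icc (digitCode x n - 2) (digitCode x n + 2) := by
  have hN : (0 : ℝ) < N := by exact_mod_cast Fin.pos (x 0)
  have h1 : |(N : ℝ) ^ n * Real.ofDigits x - (N : ℝ) ^ n * Real.ofDigits y| ≤ 1 := by
    rw [← mul_sub, abs_mul, abs_of_pos (pow_pos hN n)]
    calc _ ≤ (N : ℝ) ^ n * ((N : ℝ)⁻¹) ^ n := by gcongr
      _ = 1 := by rw [← mul_pow, mul_inv_cancel₀ hN.ne', one_pow]
  rw [pow_mul_ofDigits, pow_mul_ofDigits] at h1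
  have hx0 := Real.ofDigits_nonneg fun k => x (k + n)
  have hx1 := Real.ofDigits_le_one fun k => x (k + n)
  have hy0 := Real.ofDigits_nonneg fun k => y (k + n)
  have hy1 := Real.ofDigits_le_one fun k => y (k + n)
  obtain ⟨h2, h3⟩ := abs_le.1 h1
  have h4 : ((digitCode x n : ℕ) : ℝ) ≤ ((digitCode y n + 2 : ℕ) : ℝ) := by
    push_cast
    linarith
  have h5 : ((digitCode y n : ℕ) : ℝ) ≤ ((digitCode x n + 2 : ℕ) : ℝ) := by
    push_cast
    linarith
  rw [Nat.cast_le] at h4 h5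
  rw [Finset.mem_Icc]
  omega

theorem symbol_ext {p q : Symbols A} (h1 : p.row = q.row) (h2 : p.col = q.col) : p = q :=
  Subtype.ext (ofLex.injective (Prod.ext h1 h2))

/-- The pair of integers formed by the first `n` digits of both coordinates. -/
def pathCode (lab : Fin D ≃o Symbols A) (n : ℕ) (e : FullPath D) : ℕ × ℕ :=
  (digitCode (fun k => (lab (vertices e k)).row) n, digitCode (fun k => (lab (vertices e k)).col) n)

theorem mem_vertexCylinder_of_pathCode_eq {lab : Fin D ≃o Symbols A} {n : ℕ} {e f : FullPath D}
    (h : pathCode lab n f = pathCode lab n e) : f ∈ vertexCylinder e n := fun k hk =>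
  lab.injective <| symbol_ext (eq_of_digitCode_eq (congrArg Prod.fst h) k hk)
    (eq_of_digitCode_eq (congrArg Prod.snd h) k hk)

theorem pathMeasure_pathCode_le [NeZero D] (lab : Fin D ≃o Symbols A) (n : ℕ) (c : ℕ × ℕ) :
    pathMeasure D {e | pathCode lab n e = c} ≤ ((D : ℝ≥0∞)⁻¹) ^ n := by
  rcases Set.eq_empty_or_nonempty {e | pathCode lab n e = c} with h | ⟨e, rfl⟩
  · simp [h]
  · rw [← ENNReal.inv_pow, ← pathMeasure_vertexCylinder e n]
    exact measure_mono fun f hf => mem_vertexCylinder_of_pathCode_eq hf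

theorem abs_sub_le_of_ediam_le {E : Set (fractal A)} {r : ℝ} (hr : 0 ≤ r)
    (hE : Metric.ediam E ≤ ENNReal.ofReal r) {p q : fractal A} (hp : p ∈ E) (hq : q ∈ E)
    (k : Fin 2) : |p.1 k - q.1 k| ≤ r := by
  have h := (Metric.edist_le_ediam_of_mem hp hq).trans hE
  rw [edist_dist, ENNReal.ofReal_le_ofReal_iff hr, Subtype.dist_eq, dist_eq_norm] at h
  exact (PiLp.norm_apply_le (p.1 - q.1) k).trans h

/-- Each coordinate leaves at most 5 codes near that of a fixed point, hence 25 pairs, and each pair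
of codes determines the first n vertices, which has mass at most D^(-n). -/
theorem pathMeasure_preimage_le (hN : 2 ≤ N) [NeZero D] (lab : Fin D ≃o Symbols A) {n : ℕ}
    {E : Set (fractal A)} (hE : Metric.ediam E ≤ ((N : ℝ≥0∞)⁻¹) ^ n) :
    pathMeasure D (upsilon lab ⁻¹' E) ≤ 25 * ((D : ℝ≥0∞)⁻¹) ^ n := by
  rcases Set.eq_empty_or_nonempty (upsilon lab ⁻¹' E) with h | ⟨e, he⟩
  · simp [h]
  have hN' : (0 : ℝ) < N := by positivity
  have hE' : Metric.ediam E ≤ ENNReal.ofReal (((N : ℝ)⁻¹) ^ n) := by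
    rwa [ENNReal.ofReal_pow (by positivity), ENNReal.ofReal_inv_of_pos hN', ENNReal.ofReal_natCast]
  set a := (pathCode lab n e).1
  set b := (pathCode lab n e).2
  let S : Finset (ℕ × ℕ) := Finset.Icc (a - 2) (a + 2) ×ˢ Finset.Icc (b - 2) (b + 2)
  have hS : (S.card : ℝ≥0∞) ≤ 25 := by
    have : S.card ≤ 5 * 5 := by
      rw [Finset.card_product, Nat.card_Icc, Nat.card_Icc]
      exact Nat.mul_le_mul (by omega) (by omega)
    exact_mod_cast this
  have hsub : upsilon lab ⁻¹' E ⊆ ⋃ c ∈ S, {f | pathCode lab n f = c} := by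
    intro f hf
    have h (k : Fin 2) := abs_sub_le_of_ediam_le (by positivity) hE' he hf k
    refine Set.mem_biUnion (x := pathCode lab n f) (Finset.mem_product.2 ⟨?_, ?_⟩) rfl
    · refine digitCode_mem_Icc ?_
      simpa [coe_upsilon] using h 0
    · refine digitCode_mem_Icc ?_
      simpa [coe_upsilon] using h 1
  calc pathMeasure D (upsilon lab ⁻¹' E)
      ≤ ∑ c ∈ S, pathMeasure D {f | pathCode lab n f = c} :=
        (measure_mono hsub).trans (measure_biUnion_finset_le S _)
    _ ≤ ∑ c ∈ S, ((D : ℝ≥0∞)⁻¹) ^ n := by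
        gcongr with c
        exact pathMeasure_pathCode_le lab n c
    _ ≤ 25 * ((D : ℝ≥0∞)⁻¹) ^ n := by
        rw [Finset.sum_const, nsmul_eq_mul]
        gcongr

/-- Choose n with N^(-(n+1)) < diam E ≤ N^(-n); passing from n to n + 1 costs the factor D. Diameter
zero is separate: if D = 1 the exponent is 0 and the power is 1, otherwise the bound of level n
tends to 0. -/
theorem pathMeasure_preimage_le_ediam (hN : 2 ≤ N) [NeZero D] (lab : Fin D ≃o Symbols A)
    {E : Set (fractal A)} (hE : Metric.ediam E ≤ 1) :
    pathMeasure D (upsilon lab ⁻¹' E) ≤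
      25 * D * Metric.ediam E ^ (Real.log D / Real.log N) := by
  have hD : (D : ℝ≥0∞) ≠ 0 := by simp [NeZero.ne D]
  have hN' : (0 : ℝ) < N := by positivity
  rcases eq_or_ne (Metric.ediam E) 0 with h0 | h0
  · rcases (Nat.one_le_iff_ne_zero.2 (NeZero.ne D)).eq_or_lt with h1 | h1
    · have := pathMeasure_preimage_le (n := 0) hN lab (E := E) (by simpa using hE)
      simpa [← h1] using this
    · have hz : pathMeasure D (upsilon lab ⁻¹' E) ≤ 0 := by
        have ht : Filter.Tendsto (fun n : ℕ => 25 * ((D : ℝ≥0∞)⁻¹) ^ n) Filter.atTop (nhds 0) := by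
          simpa using ENNReal.Tendsto.const_mul (tendsto_inv_natCast_pow h1)
            (Or.inr (by simp : (25 : ℝ≥0∞) ≠ ∞))
        exact ge_of_tendsto' ht fun n => pathMeasure_preimage_le hN lab (by simp [h0])
      exact hz.trans zero_le
  · have ht : Metric.ediam E ≠ ∞ := ne_top_of_le_ne_top ENNReal.one_ne_top hE
    obtain ⟨n, h1, h2⟩ := exists_nat_pow_near_of_lt_one (x := (Metric.ediam E).toReal)
      (y := (N : ℝ)⁻¹) (ENNReal.toReal_pos h0 ht)
      (ENNReal.toReal_le_of_le_ofReal zero_le_one (by simpa using hE)) (by positivity)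
      (inv_lt_one_of_one_lt₀ (by exact_mod_cast (by omega : 1 < N)))
    have hcast (m : ℕ) : ENNReal.ofReal (((N : ℝ)⁻¹) ^ m) = ((N : ℝ≥0∞)⁻¹) ^ m := by
      rw [ENNReal.ofReal_pow (by positivity), ENNReal.ofReal_inv_of_pos hN',
        ENNReal.ofReal_natCast]
    have h1' : ((N : ℝ≥0∞)⁻¹) ^ (n + 1) ≤ Metric.ediam E := by
      rw [← hcast]
      exact (ENNReal.ofReal_le_iff_le_toReal ht).2 h1.le
    have h2' : Metric.ediam E ≤ ((N : ℝ≥0∞)⁻¹) ^ n := by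
      rw [← hcast]
      exact (ENNReal.le_ofReal_iff_toReal_le ht (by positivity)).2 h2
    calc pathMeasure D (upsilon lab ⁻¹' E) ≤ 25 * ((D : ℝ≥0∞)⁻¹) ^ n :=
          pathMeasure_preimage_le hN lab h2'
      _ = 25 * D * ((D : ℝ≥0∞)⁻¹) ^ (n + 1) := by
          rw [pow_succ', mul_assoc, ← mul_assoc (D : ℝ≥0∞), ENNReal.mul_inv_cancel hD (by simp),
            one_mul]
      _ ≤ _ := by
          rw [← inv_natCast_pow_rpow_dim hN]
          gcongr

/-- Mass distribution principle: a nonzero measure bounded by a multiple of diam^s on small sets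
lies below a multiple of the Hausdorff measure. -/
theorem hausdorffMeasure_univ_ne_zero (hN : 2 ≤ N) [NeZero D] (lab : Fin D ≃o Symbols A) :
    Measure.hausdorffMeasure (Real.log D / Real.log N) (Set.univ : Set (fractal A)) ≠ 0 := by
  have hD : (25 * D : ℝ≥0∞) ≠ 0 := by simp [NeZero.ne D]
  have hD' : (25 * D : ℝ≥0∞) ≠ ∞ := ENNReal.mul_ne_top (by simp) (by simp)
  have hm := (continuous_upsilon lab).measurable
  have hle : (25 * D : ℝ≥0∞)⁻¹ • (pathMeasure D).map (upsilon lab) ≤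
      Measure.hausdorffMeasure (Real.log D / Real.log N) := by
    refine Measure.le_hausdorffMeasure _ _ 1 one_pos fun E hE => ?_
    -- The closure has the same diameter and is measurable, so its pushforward mass is the mass of
    -- its preimage.
    rw [← Metric.ediam_closure] at hE
    calc _ ≤ (25 * D : ℝ≥0∞)⁻¹ * (pathMeasure D).map (upsilon lab) (closure E) :=
          mul_le_mul_right (measure_mono subset_closure) _
      _ ≤ (25 * D : ℝ≥0∞)⁻¹ *
            (25 * D * Metric.ediam (closure E) ^ (Real.log D / Real.log N)) := by
          rw [Measure.map_apply hm isClosed_closure.measurableSet]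
          gcongr
          exact pathMeasure_preimage_le_ediam hN lab hE
      _ = _ := by
          rw [← mul_assoc, ENNReal.inv_mul_cancel hD hD', one_mul, Metric.ediam_closure]
  intro h0
  have := hle Set.univ
  rw [h0, Measure.smul_apply, Measure.map_apply hm MeasurableSet.univ, Set.preimage_univ,
    measure_univ, smul_eq_mul, mul_one, nonpos_iff_eq_zero, ENNReal.inv_eq_zero] at this
  exact hD' this

theorem dimH_fractal (hN : 2 ≤ N) [NeZero D] (lab : Fin D ≃o Symbols A) :
    dimH (fractal A) = ENNReal.ofReal (Real.log D / Real.log N) := by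
  have h : dimH (Set.univ : Set (fractal A)) =
      ((Real.log D / Real.log N).toNNReal : ℝ≥0∞) := by
    refine dimH_of_hausdorffMeasure_ne_zero_ne_top ?_ ?_ <;>
      rw [Real.coe_toNNReal _ (dim_nonneg N D)]
    · exact hausdorffMeasure_univ_ne_zero hN lab
    · exact hausdorffMeasure_univ_ne_top hN lab
  rw [← isometry_subtype_coe.dimH_image, Set.image_univ, Subtype.range_coe] at h
  exact h

/-! ### The normalized Hausdorff measure -/

theorem isProbabilityMeasure_fractalMeasure (hN : 2 ≤ N) [NeZero D] (lab : Fin D ≃o Symbols A) :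
    IsProbabilityMeasure (fractalMeasure A D) :=
  ⟨ENNReal.inv_mul_cancel (hausdorffMeasure_univ_ne_zero hN lab)
    (hausdorffMeasure_univ_ne_top hN lab)⟩

/-- The Lipschitz and antilipschitz bounds match, so the scaling is exactly N^(-s) = 1/D, for
arbitrary sets. -/
theorem hausdorffMeasure_image_tauMap (hN : 2 ≤ N) [NeZero D] (j : Symbols A)
    (B : Set (fractal A)) :
    Measure.hausdorffMeasure (Real.log D / Real.log N) (tauMap j '' B) =
      (D : ℝ≥0∞)⁻¹ * Measure.hausdorffMeasure (Real.log D / Real.log N) B := by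
  have hD : (D : ℝ≥0∞) ≠ 0 := by simp [NeZero.ne D]
  have hN0 : (N : NNReal) ≠ 0 := by exact_mod_cast (by omega : N ≠ 0)
  refine le_antisymm ?_ ?_
  · have h := (lipschitzWith_tauMap j).hausdorffMeasure_image_le (dim_nonneg N D) B
    rwa [ENNReal.coe_inv hN0, ENNReal.inv_rpow, ENNReal.coe_natCast, natCast_rpow_dim hN] at h
  · have h := (antilipschitzWith_tauMap hN j).le_hausdorffMeasure_image (dim_nonneg N D) B
    rw [ENNReal.coe_natCast, natCast_rpow_dim hN] at h
    calc _ ≤ (D : ℝ≥0∞)⁻¹ * (D * _) := mul_le_mul_right h _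
      _ = _ := by rw [← mul_assoc, ENNReal.inv_mul_cancel hD (by simp), one_mul]

theorem fractalMeasure_image_tauMap (hN : 2 ≤ N) [NeZero D] (j : Symbols A)
    (B : Set (fractal A)) :
    fractalMeasure A D (tauMap j '' B) = (D : ℝ≥0∞)⁻¹ * fractalMeasure A D B := by
  simp only [fractalMeasure, Measure.smul_apply, smul_eq_mul, hausdorffMeasure_image_tauMap hN]
  rw [mul_left_comm]

theorem iUnion_range_tauMap (lab : Fin D ≃o Symbols A) :
    ⋃ i, Set.range (tauMap (lab i)) = Set.univ := by
  refine Set.eq_univ_of_forall fun p => ?_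
  obtain ⟨e, rfl⟩ := upsilon_surjective lab p
  refine Set.mem_iUnion.2 ⟨vertices e 0, upsilon lab (pathShift e), ?_⟩
  rw [← upsilon_pathPrepend, pathPrepend_pathShift]

/-! ### Null overlaps and almost everywhere unique coding -/

theorem measure_inter_eq_zero_of_sum_le {X ι : Type*} [MeasurableSpace X] [Fintype ι]
    {μ : Measure X} [IsFiniteMeasure μ] {B : ι → Set X} (hB : ∀ i, MeasurableSet (B i))
    (h : ∑ i, μ (B i) ≤ μ (⋃ i, B i)) {i j : ι} (hij : i ≠ j) : μ (B i ∩ B j) = 0 := by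
  classical
  -- The part of B i inside B j is already covered by B j; if it had positive mass, dropping it
  -- would make the union smaller than the sum.
  have hsub : ⋃ k, B k ⊆ (B i \ B j) ∪ ⋃ k ∈ Finset.univ.erase i, B k := by
    intro x hx
    obtain ⟨k, hk⟩ := Set.mem_iUnion.1 hx
    by_cases hj : x ∈ B j
    · exact Or.inr (Set.mem_biUnion (x := j) (by simpa using hij.symm) hj)
    · by_cases hki : k = i
      · exact Or.inl ⟨hki ▸ hk, hj⟩
      · exact Or.inr (Set.mem_biUnion (x := k) (by simpa using hki) hk)
  have h1 : μ (⋃ k, B k) ≤ μ (B i \ B j) + ∑ k ∈ Finset.univ.erase i, μ (B k) :=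
    (measure_mono hsub).trans ((measure_union_le _ _).trans
      (add_le_add_right (measure_biUnion_finset_le _ _) _))
  have h2 := h.trans h1
  rw [← Finset.add_sum_erase _ _ (Finset.mem_univ i)] at h2
  have h3 : μ (B i) ≤ μ (B i \ B j) :=
    (ENNReal.add_le_add_iff_right (ENNReal.sum_ne_top.2 fun k _ => measure_ne_top μ _)).1 h2
  rw [← measure_inter_add_sdiff (B i) (hB j)] at h3
  by_contra h0
  exact absurd h3 (not_le.2 (by
    rw [add_comm]
    exact ENNReal.lt_add_right (measure_ne_top μ _) h0))

/-- D pieces of mass 1/D cover a space of mass 1, which leaves no room for overlap. No separation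
condition on the pieces is needed. -/
theorem fractalMeasure_range_inter (hN : 2 ≤ N) [NeZero D] (lab : Fin D ≃o Symbols A)
    {i j : Fin D} (hij : i ≠ j) :
    fractalMeasure A D (Set.range (tauMap (lab i)) ∩ Set.range (tauMap (lab j))) = 0 := by
  have := isProbabilityMeasure_fractalMeasure hN lab
  refine measure_inter_eq_zero_of_sum_le
    (B := fun i => Set.range (tauMap (lab i)))
    (fun i => (measurableEmbedding_tauMap hN lab (lab i)).measurableSet_range) ?_ hij
  rw [iUnion_range_tauMap]
  simp only [← Set.image_univ, fractalMeasure_image_tauMap hN]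
  simp [ENNReal.mul_inv_cancel, NeZero.ne D]

/-- The points coded by two paths that differ for the first time at index `n`. -/
def overlap (lab : Fin D ≃o Symbols A) (n : ℕ) : Set (fractal A) :=
  {p | ∃ e f, upsilon lab e = p ∧ upsilon lab f = p ∧ vertices e n ≠ vertices f n ∧
    ∀ k < n, vertices e k = vertices f k}

theorem fractalMeasure_overlap (hN : 2 ≤ N) [NeZero D] (lab : Fin D ≃o Symbols A) (n : ℕ) :
    fractalMeasure A D (overlap lab n) = 0 := by
  have hmem (e : FullPath D) :
      upsilon lab e = tauMap (lab (vertices e 0)) (upsilon lab (pathShift e)) := by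
    rw [← upsilon_pathPrepend, pathPrepend_pathShift]
  induction n with
  | zero =>
    have hsub : overlap lab 0 ⊆ ⋃ i : Fin D, ⋃ j : Fin D, ⋃ _ : i ≠ j,
        Set.range (tauMap (lab i)) ∩ Set.range (tauMap (lab j)) := by
      rintro p ⟨e, f, he, hf, hne, -⟩
      simp only [Set.mem_iUnion]
      exact ⟨_, _, hne, ⟨_, (hmem e).symm.trans he⟩, ⟨_, (hmem f).symm.trans hf⟩⟩
    refine measure_mono_null hsub ?_
    simp only [measure_iUnion_null_iff]
    exact fun i j hij => fractalMeasure_range_inter hN lab hij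
  | succ n ih =>
    -- The two codes share their first letter; injectivity of the similarity lets it be removed from
    -- both.
    have hsub : overlap lab (n + 1) ⊆ ⋃ i : Fin D, tauMap (lab i) '' overlap lab n := by
      rintro p ⟨e, f, he, hf, hne, hk⟩
      have h0 := hk 0 n.succ_pos
      refine Set.mem_iUnion.2 ⟨vertices e 0, upsilon lab (pathShift e),
        ⟨pathShift e, pathShift f, rfl, ?_, hne, fun k h => hk (k + 1) (Nat.succ_lt_succ h)⟩,
        (hmem e).symm.trans he⟩
      refine (antilipschitzWith_tauMap hN (lab (vertices e 0))).injective ?_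
      rw [← hmem e, he, h0, ← hmem f, hf]
    refine measure_mono_null hsub (measure_iUnion_null fun i => ?_)
    rw [fractalMeasure_image_tauMap hN, ih, mul_zero]

/-- Almost every point is coded by exactly one path. -/
theorem exists_measurableSet_injOn_upsilon (hN : 2 ≤ N) [NeZero D] (lab : Fin D ≃o Symbols A) :
    ∃ G : Set (fractal A), MeasurableSet G ∧ fractalMeasure A D Gᶜ = 0 ∧
      ∀ e f, upsilon lab e ∈ G → upsilon lab e = upsilon lab f → e = f := by
  have h0 : fractalMeasure A D (⋃ n, overlap lab n) = 0 :=
    measure_iUnion_null fun n => fractalMeasure_overlap hN lab n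
  -- A measurable hull of the same measure avoids having to prove that the overlaps are Borel.
  refine ⟨(toMeasurable (fractalMeasure A D) (⋃ n, overlap lab n))ᶜ,
    (measurableSet_toMeasurable _ _).compl, by rwa [compl_compl, measure_toMeasurable],
    fun e f he hef => ?_⟩
  by_contra hne
  have hex : ∃ n, vertices e n ≠ vertices f n := by
    by_contra! h
    exact hne (vertices_injective (funext h))
  classical
  exact he (subset_toMeasurable _ _ (Set.mem_iUnion.2 ⟨Nat.find hex, e, f, rfl, hef.symm,
    Nat.find_spec hex, fun k hk => not_not.1 (Nat.find_min hex hk)⟩))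

end Geometry

/-! ### The coding map is an isomorphism of measure spaces -/

section MeasureIso

variable {N D : ℕ} {A : Matrix (Fin N) (Fin N) ℕ}

theorem fractalMeasure_image_vertexCylinder (hN : 2 ≤ N) [NeZero D] (lab : Fin D ≃o Symbols A)
    (e : FullPath D) (n : ℕ) :
    fractalMeasure A D (upsilon lab '' vertexCylinder e n) = ((D : ℝ≥0∞) ^ n)⁻¹ := by
  have := isProbabilityMeasure_fractalMeasure hN lab
  rw [ENNReal.inv_pow]
  induction n generalizing e with
  | zero => simp [vertexCylinder_zero, (upsilon_surjective lab).range_eq]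
  | succ n ih =>
    rw [image_upsilon_vertexCylinder_succ, fractalMeasure_image_tauMap hN, ih, pow_succ']

/-- The map `Υ` has a measurable, measure preserving inverse off a null set. -/
theorem exists_section_upsilon (hN : 2 ≤ N) [NeZero D] (lab : Fin D ≃o Symbols A) :
    ∃ (G : Set (fractal A)) (s : fractal A → FullPath D), MeasurableSet G ∧
      fractalMeasure A D Gᶜ = 0 ∧ MeasurePreserving s (fractalMeasure A D) (pathMeasure D) ∧
      (∀ p ∈ G, upsilon lab (s p) = p) ∧ ∀ e, upsilon lab e ∈ G → s (upsilon lab e) = e := by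
  obtain ⟨G, hG, hG0, hinj⟩ := exists_measurableSet_injOn_upsilon hN lab
  have hm := (continuous_upsilon lab).measurable
  have : StandardBorelSpace (upsilon lab ⁻¹' G) := (hm hG).standardBorel
  -- Lusin–Souslin: an injective Borel map on a standard Borel space is a measurable embedding, so
  -- its inverse extends to a measurable s.
  have hf : MeasurableEmbedding fun e : upsilon lab ⁻¹' G => upsilon lab e :=
    (hm.comp measurable_subtype_coe).measurableEmbedding
      fun e f h => Subtype.ext (hinj e f e.2 h)
  obtain ⟨s, hs, hsf⟩ := hf.exists_measurable_extend (g := Subtype.val) measurable_subtype_coe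
    fun _ => inferInstance
  have hleft : ∀ e, upsilon lab e ∈ G → s (upsilon lab e) = e := fun e he =>
    congrFun hsf ⟨e, he⟩
  have hright : ∀ p ∈ G, upsilon lab (s p) = p := fun p hp => by
    obtain ⟨e, rfl⟩ := upsilon_surjective lab p
    rw [hleft e hp]
  refine ⟨G, s, hG, hG0, ⟨hs, eq_pathMeasure fun e n => ?_⟩, hright, hleft⟩
  rw [Measure.map_apply hs (measurableSet_vertexCylinder e n),
    ← fractalMeasure_image_vertexCylinder hN lab e n]
  -- On G the preimage of a cylinder under s is the image of that cylinder under `upsilon`, whose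
  -- mass is known from the scaling.
  refine measure_congr ?_
  filter_upwards [mem_ae_iff.2 hG0] with p hp
  refine propext ⟨fun h => ⟨s p, h, hright p hp⟩, ?_⟩
  rintro ⟨f, hf, rfl⟩
  change s _ ∈ _
  rwa [hleft f hp]

/-- Since M = s_*H and Υ ∘ s is the identity almost everywhere, Υ_*M = H. -/
theorem measurePreserving_upsilon (hN : 2 ≤ N) [NeZero D] (lab : Fin D ≃o Symbols A) :
    MeasurePreserving (upsilon lab) (pathMeasure D) (fractalMeasure A D) := by
  obtain ⟨G, s, -, hG0, hs, hright, -⟩ := exists_section_upsilon hN lab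
  have hm := (continuous_upsilon lab).measurable
  refine ⟨hm, ?_⟩
  rw [← hs.map_eq, Measure.map_map hm hs.measurable]
  have h : upsilon lab ∘ s =ᵐ[fractalMeasure A D] id := by
    filter_upwards [mem_ae_iff.2 hG0] with p hp using hright p hp
  rw [Measure.map_congr h, Measure.map_id]

theorem isMeasureIso_upsilon (hN : 2 ≤ N) [NeZero D] (lab : Fin D ≃o Symbols A) :
    IsMeasureIso (pathMeasure D) (fractalMeasure A D) (upsilon lab) := by
  obtain ⟨G, s, hG, hG0, hs, hright, hleft⟩ := exists_section_upsilon hN lab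
  have hm := measurePreserving_upsilon hN lab
  refine ⟨hm, upsilon lab ⁻¹' G, G, hm.measurable hG, hG, ?_, hG0, ?_⟩
  · rw [← Set.preimage_compl, hm.measure_preimage hG.compl.nullMeasurableSet, hG0]
  · have hmem (p : G) : s p ∈ upsilon lab ⁻¹' G := by
      rw [Set.mem_preimage, hright p p.2]
      exact p.2
    let g : (upsilon lab ⁻¹' G) ≃ᵐ G :=
      { toFun := fun e => ⟨upsilon lab e, e.2⟩
        invFun := fun p => ⟨s p, hmem p⟩
        left_inv := fun e => Subtype.ext (hleft e e.2)
        right_inv := fun p => Subtype.ext (hright p p.2)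
        measurable_toFun := (hm.measurable.comp measurable_subtype_coe).subtype_mk
        measurable_invFun := (hs.measurable.comp measurable_subtype_coe).subtype_mk (h := hmem) }
    exact ⟨g, fun _ => rfl⟩

/-! ### The semibranching function systems -/

theorem isSemibranching_of_comap_eq {X : Type*} [MeasurableSpace X] [NeZero D] {μ : Measure X}
    [IsFiniteMeasure μ] {σi : Fin D → X → X} {σ : X → X} (hm : ∀ i, MeasurableEmbedding (σi i))
    (hcover : ⋃ i, Set.range (σi i) = Set.univ)
    (hdisj : ∀ i j, i ≠ j → μ (Set.range (σi i) ∩ Set.range (σi j)) = 0)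
    (hc : ∀ i, μ.comap (σi i) = (D : ℝ≥0∞)⁻¹ • μ) (hσ : ∀ i, ∀ᵐ x ∂μ, σ (σi i x) = x) :
    IsSemibranching μ σi σ where
  measurable i := (hm i).measurable.aemeasurable
  cover := by simp [hcover]
  disjoint := hdisj
  comap_apply i B _ := (hm i).comap_apply μ B
  absolutelyContinuous i := by
    rw [hc i]
    exact Measure.smul_absolutelyContinuous
  deriv_pos i := by
    rw [hc i]
    filter_upwards [Measure.rnDeriv_smul_left_of_ne_top μ μ
      (ENNReal.inv_ne_top.2 (Nat.cast_ne_zero.2 (NeZero.ne D))), Measure.rnDeriv_self μ] with x h1 h2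
    rw [h1, Pi.smul_apply, h2]
    simp
  coding := hσ

theorem isSemibranching_path [NeZero D] :
    IsSemibranching (pathMeasure D) (fun i : Fin D => pathPrepend i) pathShift := by
  refine isSemibranching_of_comap_eq measurableEmbedding_pathPrepend ?_ ?_ comap_pathPrepend
    fun i => Filter.Eventually.of_forall (pathShift_pathPrepend i)
  · exact Set.eq_univ_of_forall fun e => Set.mem_iUnion.2 ⟨_, _, pathPrepend_pathShift e⟩
  · intro i j hij
    have h : Set.range (pathPrepend i) ∩ Set.range (pathPrepend j) = ∅ := by
      rw [range_pathPrepend, range_pathPrepend]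
      exact Set.eq_empty_of_forall_notMem fun e ⟨h1, h2⟩ => hij (h1.symm.trans h2)
    rw [h, measure_empty]

/-! ### The coding map on the fractal -/

theorem exists_path_of_digits (lab : Fin D ≃o Symbols A) {x y : ℕ → Fin N}
    (hA : ∀ n, A (x n) (y n) = 1) : ∃ e : FullPath D, (upsilon lab e : Plane) = digitPoint x y ∧
      ∀ n, (lab (vertices e n)).row = x n ∧ (lab (vertices e n)).col = y n := by
  have h (n : ℕ) : lab (vertices (pathOfVertices fun n => lab.symm ⟨toLex (x n, y n), hA n⟩) n) =
      ⟨toLex (x n, y n), hA n⟩ := lab.apply_symm_apply _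
  refine ⟨pathOfVertices fun n => lab.symm ⟨toLex (x n, y n), hA n⟩, ?_, fun n => by
    rw [h]; exact ⟨rfl, rfl⟩⟩
  rw [coe_upsilon, digitPoint_eq]
  simp only [h]
  rfl

/-- At a uniquely coded point the expansion chosen by τ has to be the one given by e, so τ removes
the first letter of e. -/
theorem codingMap_upsilon (hN : 2 ≤ N) (lab : Fin D ≃o Symbols A) {τ : fractal A → fractal A}
    (hτ : IsCodingMap A τ) {e : FullPath D} (he : ∀ f, upsilon lab e = upsilon lab f → e = f) :
    τ (upsilon lab e) = upsilon lab (pathShift e) := by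
  obtain ⟨x, y, hA, hp, hτp⟩ := hτ (upsilon lab e)
  obtain ⟨f, hf, hxy⟩ := exists_path_of_digits lab hA
  obtain rfl := he f (Subtype.ext (hp.trans hf.symm))
  have hN' : (N : ℝ) ≠ 0 := by positivity
  refine Subtype.ext (hτp.trans ?_)
  rw [← (hxy 0).1, ← (hxy 0).2]
  have h : upsilon lab e = tauMap (lab (vertices e 0)) (upsilon lab (pathShift e)) := by
    rw [← upsilon_pathPrepend, pathPrepend_pathShift]
  rw [h]
  ext k
  fin_cases k <;> simp [tauMap, mul_div_cancel₀, hN']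

theorem comap_tauMap (hN : 2 ≤ N) [NeZero D] (lab : Fin D ≃o Symbols A) (i : Fin D) :
    (fractalMeasure A D).comap (tauMap (lab i)) = (D : ℝ≥0∞)⁻¹ • fractalMeasure A D := by
  ext B _
  rw [(measurableEmbedding_tauMap hN lab _).comap_apply, fractalMeasure_image_tauMap hN]
  rfl

theorem isSemibranching_fractal (hN : 2 ≤ N) [NeZero D] (lab : Fin D ≃o Symbols A)
    {τ : fractal A → fractal A} (hτ : IsCodingMap A τ) :
    IsSemibranching (fractalMeasure A D) (fun i : Fin D => tauMap (lab i)) τ := by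
  have := isProbabilityMeasure_fractalMeasure hN lab
  obtain ⟨G, s, -, hG0, -, -, hleft⟩ := exists_section_upsilon hN lab
  refine isSemibranching_of_comap_eq (fun i => measurableEmbedding_tauMap hN lab (lab i))
    (iUnion_range_tauMap lab) (fun i j => fractalMeasure_range_inter hN lab)
    (comap_tauMap hN lab) fun i => ?_
  -- Unique coding is needed at the image of p under the similarity. Preimages of null sets are null
  -- because images are scaled by the nonzero factor 1/D.
  have h0 : fractalMeasure A D (tauMap (lab i) ⁻¹' Gᶜ) = 0 := by
    have h := fractalMeasure_image_tauMap (D := D) hN (lab i) (tauMap (lab i) ⁻¹' Gᶜ)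
    rw [measure_mono_null (Set.image_preimage_subset _ _) hG0, eq_comm, mul_eq_zero] at h
    exact h.resolve_left (by simp)
  filter_upwards [measure_eq_zero_iff_ae_notMem.1 h0] with p hp
  obtain ⟨e, rfl⟩ := upsilon_surjective lab p
  rw [Set.mem_preimage, Set.notMem_compl_iff] at hp
  rw [← upsilon_pathPrepend] at hp ⊢
  exact codingMap_upsilon hN lab hτ fun f hf => by
    rw [← hleft _ hp, hf, hleft f (hf ▸ hp)]

end MeasureIso

/-! ### The operators -/

section Operators

/-- Weighted composition operators on `L²`. -/
theorem exists_weightedComposition {X : Type*} [MeasurableSpace X] {μ : Measure X} {φ : X → X}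
    (hφ : Measurable φ) {c : ℝ≥0∞} (hc : c ≠ ∞) (hle : μ.map φ ≤ c • μ) {w : X → ℂ}
    (hw : Measurable w) {C : ℝ} (hC : ∀ x, ‖w x‖ ≤ C) :
    ∃ W : Lp ℂ 2 μ →L[ℂ] Lp ℂ 2 μ, ∀ ξ, W ξ =ᵐ[μ] fun x => w x * ξ (φ x) := by
  have hq : Measure.QuasiMeasurePreserving φ μ μ :=
    ⟨hφ, (Measure.absolutelyContinuous_of_le hle).trans Measure.smul_absolutelyContinuous⟩
  have hcomp (ξ : Lp ℂ 2 μ) : MemLp (fun x => ξ (φ x)) 2 μ :=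
    ((Lp.memLp ξ).of_measure_le_smul hc hle).comp_of_map hφ.aemeasurable
  have hbound (ξ : Lp ℂ 2 μ) : ∀ᵐ x ∂μ, ‖w x * ξ (φ x)‖ ≤ C * ‖ξ (φ x)‖ :=
    Filter.Eventually.of_forall fun x => by
      rw [norm_mul]
      gcongr
      exact hC x
  have hmem (ξ : Lp ℂ 2 μ) : MemLp (fun x => w x * ξ (φ x)) 2 μ :=
    (hcomp ξ).of_le_mul (hw.aestronglyMeasurable.mul (hcomp ξ).1) (hbound ξ)
  let L : Lp ℂ 2 μ →ₗ[ℂ] Lp ℂ 2 μ :=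
    { toFun := fun ξ => (hmem ξ).toLp
      map_add' := fun ξ η => by
        refine Lp.ext ?_
        filter_upwards [(hmem (ξ + η)).coeFn_toLp, (hmem ξ).coeFn_toLp, (hmem η).coeFn_toLp,
          Lp.coeFn_add (hmem ξ).toLp (hmem η).toLp, hq.ae (Lp.coeFn_add ξ η)] with x h1 h2 h3 h4 h5
        rw [h1, h4, Pi.add_apply, h2, h3, h5, Pi.add_apply, mul_add]
      map_smul' := fun a ξ => by
        refine Lp.ext ?_
        filter_upwards [(hmem (a • ξ)).coeFn_toLp, (hmem ξ).coeFn_toLp,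
          Lp.coeFn_smul a (hmem ξ).toLp, hq.ae (Lp.coeFn_smul a ξ)] with x h1 h2 h3 h4
        rw [RingHom.id_apply, h1, h3, Pi.smul_apply, h2, h4, Pi.smul_apply, smul_eq_mul,
          smul_eq_mul, mul_left_comm] }
  refine ⟨L.mkContinuous (C * (c ^ (1 / (2 : ℝ≥0∞)).toReal).toReal) fun ξ => ?_,
    fun ξ => (hmem ξ).coeFn_toLp⟩
  -- On an empty space the bound on w does not force C to be nonnegative.
  rcases isEmpty_or_nonempty X with hX | ⟨⟨x⟩⟩
  · have h0 (ξ : Lp ℂ 2 μ) : ξ = 0 := Lp.ext (Filter.Eventually.of_forall fun x => hX.elim x)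
    simp [h0 ξ]
  · have hC0 : 0 ≤ C := (norm_nonneg _).trans (hC x)
    have hc' : c ^ (1 / (2 : ℝ≥0∞)).toReal ≠ ∞ :=
      ENNReal.rpow_ne_top_of_nonneg ENNReal.toReal_nonneg hc
    have h1 : eLpNorm (fun x => w x * ξ (φ x)) 2 μ ≤
        ENNReal.ofReal C * (c ^ (1 / (2 : ℝ≥0∞)).toReal * eLpNorm ξ 2 μ) := by
      refine (eLpNorm_le_mul_eLpNorm_of_ae_le_mul (hbound ξ) 2).trans ?_
      gcongr
      change eLpNorm (ξ ∘ φ) 2 μ ≤ _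
      rw [← eLpNorm_map_measure ((Lp.aestronglyMeasurable ξ).mono_ac hq.absolutelyContinuous)
        hφ.aemeasurable]
      refine (eLpNorm_mono_measure _ hle).trans ?_
      rw [eLpNorm_smul_measure_of_ne_top (by simp), smul_eq_mul]
    have h2 := ENNReal.toReal_mono (ENNReal.mul_ne_top ENNReal.ofReal_ne_top
      (ENNReal.mul_ne_top hc' (Lp.eLpNorm_ne_top ξ))) h1
    rw [ENNReal.toReal_mul, ENNReal.toReal_mul, ENNReal.toReal_ofReal hC0, ← mul_assoc] at h2
    rw [Lp.norm_def ξ]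
    exact (Lp.norm_toLp _ (hmem ξ)).trans_le h2

theorem rpow_inv_natCast (D : ℕ) :
    ((((D : ℝ≥0∞)⁻¹).toReal ^ (-(1 / 2 : ℝ)) : ℝ) : ℂ) = (√(D : ℝ) : ℝ) := by
  rw [ENNReal.toReal_inv, ENNReal.toReal_natCast, Real.rpow_neg (by positivity),
    Real.inv_rpow (by positivity), inv_inv, Real.sqrt_eq_rpow]

theorem rnDeriv_inv_smul_self {X : Type*} [MeasurableSpace X] {μ : Measure X} [IsFiniteMeasure μ]
    {D : ℕ} [NeZero D] : ∀ᵐ x ∂μ, (((D : ℝ≥0∞)⁻¹) • μ).rnDeriv μ x = (D : ℝ≥0∞)⁻¹ := by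
  filter_upwards [Measure.rnDeriv_smul_left_of_ne_top μ μ
    (ENNReal.inv_ne_top.2 (Nat.cast_ne_zero.2 (NeZero.ne D))), Measure.rnDeriv_self μ] with x h1 h2
  rw [h1, Pi.smul_apply, h2, smul_eq_mul, mul_one]

theorem semibranchingFun_apply {X : Type*} [MeasurableSpace X] {μ : Measure X} {D : ℕ}
    {σi σ : X → X} {x : X} (ξ : X → ℂ)
    (h : (μ.comap σi).rnDeriv μ (σ x) = (D : ℝ≥0∞)⁻¹) :
    semibranchingFun μ σi σ ξ x =
      (Set.range σi).indicator (fun _ => ((√(D : ℝ) : ℝ) : ℂ)) x * ξ (σ x) := by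
  classical
  rw [semibranchingFun, Set.indicator_apply, Set.indicator_apply, h, rpow_inv_natCast]
  split_ifs <;> simp

theorem indicator_range_pathPrepend {D : ℕ} (i : Fin D) (c : ℂ) (e : FullPath D) :
    (Set.range (pathPrepend i)).indicator (fun _ => c) e = if i = vertices e 0 then c else 0 := by
  rw [range_pathPrepend]
  split_ifs with h
  · exact Set.indicator_of_mem (s := {f : FullPath D | vertices f 0 = i}) h.symm _
  · exact Set.indicator_of_notMem (s := {f : FullPath D | vertices f 0 = i}) (fun h' => h h'.symm) _

variable {D : ℕ} [NeZero D]

/-- The family R is the candidate for the adjoints: S moves mass by the shift with weight √D on one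
branch, R pulls back along that branch with weight 1/√D. -/
theorem exists_pathOperators :
    ∃ S R : Fin D → (Lp ℂ 2 (pathMeasure D) →L[ℂ] Lp ℂ 2 (pathMeasure D)),
      (∀ i ξ, S i ξ =ᵐ[pathMeasure D] fun e =>
        (Set.range (pathPrepend i)).indicator (fun _ => ((√(D : ℝ) : ℝ) : ℂ)) e *
          ξ (pathShift e)) ∧
      ∀ i ξ, R i ξ =ᵐ[pathMeasure D] fun e => (((√(D : ℝ))⁻¹ : ℝ) : ℂ) * ξ (pathPrepend i e) := by
  have hS (i : Fin D) := exists_weightedComposition (μ := pathMeasure D) (c := 1)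
    continuous_pathShift.measurable
    (by simp) (by rw [one_smul, measurePreserving_pathShift.map_eq])
    (w := (Set.range (pathPrepend i)).indicator fun _ => ((√(D : ℝ) : ℝ) : ℂ))
    (measurable_const.indicator (measurableSet_range_pathPrepend i)) (C := √(D : ℝ))
    fun e => (norm_indicator_le_norm_self _ e).trans
      (by simp [abs_of_nonneg (Real.sqrt_nonneg _)])
  have hR (i : Fin D) := exists_weightedComposition (μ := pathMeasure D)
    (continuous_pathPrepend i).measurable (by simp) (map_pathPrepend_le i)
    (w := fun _ => (((√(D : ℝ))⁻¹ : ℝ) : ℂ)) measurable_const (C := (√(D : ℝ))⁻¹)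
    fun e => by simp [abs_of_nonneg (Real.sqrt_nonneg _)]
  choose S hS using hS
  choose R hR using hR
  exact ⟨S, R, hS, hR⟩

theorem quasiMeasurePreserving_pathPrepend (i : Fin D) :
    Measure.QuasiMeasurePreserving (pathPrepend i) (pathMeasure D) (pathMeasure D) :=
  ⟨(continuous_pathPrepend i).measurable,
    (Measure.absolutelyContinuous_of_le (map_pathPrepend_le i)).trans
      Measure.smul_absolutelyContinuous⟩

theorem setIntegral_range_pathPrepend (i : Fin D) (f : FullPath D → ℂ) :
    ∫ e in Set.range (pathPrepend i), f e ∂pathMeasure D =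
      (D : ℂ)⁻¹ * ∫ e, f (pathPrepend i e) ∂pathMeasure D := by
  rw [← (measurableEmbedding_pathPrepend i).map_comap,
    (measurableEmbedding_pathPrepend i).integral_map, comap_pathPrepend, integral_smul_measure]
  simp

theorem sqrt_natCast_ne_zero : ((√(D : ℝ) : ℝ) : ℂ) ≠ 0 := by
  have : (0 : ℝ) < D := by exact_mod_cast Nat.pos_of_neZero D
  exact_mod_cast (Real.sqrt_pos.2 this).ne'

/-- The operators of the path system satisfy the Cuntz relations. -/
theorem exists_pathRep :
    ∃ S : Fin D → (Lp ℂ 2 (pathMeasure D) →L[ℂ] Lp ℂ 2 (pathMeasure D)),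
      (∀ i ξ, S i ξ =ᵐ[pathMeasure D] fun e =>
        (Set.range (pathPrepend i)).indicator (fun _ => ((√(D : ℝ) : ℝ) : ℂ)) e *
          ξ (pathShift e)) ∧ IsCuntzFamily S := by
  classical
  obtain ⟨S, R, hS, hR⟩ := exists_pathOperators (D := D)
  have hsq : ((√(D : ℝ) : ℝ) : ℂ) * ((√(D : ℝ) : ℝ) : ℂ) = D := by
    rw [← Complex.ofReal_mul, Real.mul_self_sqrt (Nat.cast_nonneg D), Complex.ofReal_natCast]
  -- Change of variables along the branch contributes 1/D, which turns the weight √D into 1/√D.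
  have hadj (i : Fin D) : ContinuousLinearMap.adjoint (S i) = R i := by
    refine ((ContinuousLinearMap.eq_adjoint_iff _ _).2 fun ξ η => ?_).symm
    rw [L2.inner_def, L2.inner_def]
    have h1 : ∫ e, inner ℂ (R i ξ e) (η e) ∂pathMeasure D =
        ((√(D : ℝ) : ℝ) : ℂ)⁻¹ * ∫ e, inner ℂ (ξ (pathPrepend i e)) (η e) ∂pathMeasure D := by
      rw [← integral_const_mul]
      refine integral_congr_ae ?_
      filter_upwards [hR i ξ] with e he
      rw [he]
      simp only [RCLike.inner_apply, map_mul, Complex.ofReal_inv, map_inv₀, Complex.conj_ofReal]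
      ring
    have h2 : ∫ e, inner ℂ (ξ e) (S i η e) ∂pathMeasure D =
        ∫ e in Set.range (pathPrepend i), ((√(D : ℝ) : ℝ) : ℂ) * inner ℂ (ξ e) (η (pathShift e))
          ∂pathMeasure D := by
      rw [← integral_indicator (measurableSet_range_pathPrepend i)]
      refine integral_congr_ae ?_
      filter_upwards [hS i η] with e he
      rw [he, Set.indicator_apply, Set.indicator_apply]
      simp only [RCLike.inner_apply]
      split_ifs <;> simp [mul_assoc]
    rw [h1, h2, setIntegral_range_pathPrepend, integral_const_mul, ← hsq, mul_inv, mul_assoc,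
      inv_mul_cancel_left₀ sqrt_natCast_ne_zero]
    rfl
  refine ⟨S, hS, fun i j => ?_, ?_⟩
  · rw [hadj]
    refine ContinuousLinearMap.ext fun ξ => Lp.ext ?_
    filter_upwards [hR j (S i ξ), (quasiMeasurePreserving_pathPrepend j).ae (hS i ξ),
      Lp.coeFn_zero ℂ 2 (pathMeasure D)] with e h1 h2 h3
    rw [ContinuousLinearMap.comp_apply, h1, h2, pathShift_pathPrepend,
      indicator_range_pathPrepend, vertices_pathPrepend_zero]
    by_cases hij : i = j
    · subst hij
      rw [if_pos rfl, if_pos rfl, Complex.ofReal_inv, inv_mul_cancel_left₀ sqrt_natCast_ne_zero]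
      rfl
    · rw [if_neg hij, if_neg hij, zero_mul, mul_zero,
        zero_apply, h3]
      rfl
  · refine ContinuousLinearMap.ext fun ξ => Lp.ext ?_
    -- S i (R i) is the projection onto functions supported on paths starting at i; these supports
    -- partition the path space.
    have hSR (i : Fin D) : S i (R i ξ) =ᵐ[pathMeasure D]
        fun e => if i = vertices e 0 then ξ e else 0 := by
      filter_upwards [hS i (R i ξ),
        measurePreserving_pathShift.quasiMeasurePreserving.ae (hR i ξ)] with e h1 h2
      rw [h1, h2, indicator_range_pathPrepend]
      by_cases hi : i = vertices e 0
      · subst hi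
        rw [if_pos rfl, if_pos rfl, Complex.ofReal_inv, mul_inv_cancel_left₀ sqrt_natCast_ne_zero,
          pathPrepend_pathShift]
      · rw [if_neg hi, if_neg hi, zero_mul]
    simp only [sum_apply, ContinuousLinearMap.comp_apply, hadj,
      ContinuousLinearMap.id_apply]
    filter_upwards [Lp.coeFn_finsetSum Finset.univ fun i => S i (R i ξ), ae_all_iff.2 hSR]
      with e h1 h2
    rw [h1, Finset.sum_apply]
    simp [h2]

theorem IsCuntzFamily.conj {H K : Type*} [NormedAddCommGroup H] [InnerProductSpace ℂ H]
    [CompleteSpace H] [NormedAddCommGroup K] [InnerProductSpace ℂ K] [CompleteSpace K] {D : ℕ}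
    {S : Fin D → (H →L[ℂ] H)} (hS : IsCuntzFamily S) (U : K ≃ₗᵢ[ℂ] H) :
    IsCuntzFamily fun i => (U.symm.toContinuousLinearEquiv : H →L[ℂ] K).comp
      ((S i).comp (U.toContinuousLinearEquiv : K →L[ℂ] H)) := by
  have hadj (i : Fin D) : ContinuousLinearMap.adjoint
      ((U.symm.toContinuousLinearEquiv : H →L[ℂ] K).comp
        ((S i).comp (U.toContinuousLinearEquiv : K →L[ℂ] H))) =
      (U.symm.toContinuousLinearEquiv : H →L[ℂ] K).comp
        ((ContinuousLinearMap.adjoint (S i)).comp (U.toContinuousLinearEquiv : K →L[ℂ] H)) := by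
    refine ((ContinuousLinearMap.eq_adjoint_iff _ _).2 fun ξ η => ?_).symm
    change inner ℂ (U.symm (ContinuousLinearMap.adjoint (S i) (U ξ))) η =
      inner ℂ ξ (U.symm (S i (U η)))
    rw [← U.inner_map_map, U.apply_symm_apply, ContinuousLinearMap.adjoint_inner_left,
      ← U.inner_map_map ξ, U.apply_symm_apply]
  refine ⟨fun i j => ?_, ?_⟩
  · rw [hadj]
    ext ξ
    have h := congrArg U.symm (congrArg (fun T : H →L[ℂ] H => T (U ξ)) (hS.1 i j))
    change U.symm (ContinuousLinearMap.adjoint (S j) (U (U.symm (S i (U ξ))))) = _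
    rw [U.apply_symm_apply]
    refine h.trans ?_
    split_ifs <;> simp
  · ext ξ
    have h := congrArg U.symm (congrArg (fun T : H →L[ℂ] H => T (U ξ)) hS.2)
    simp only [sum_apply, ContinuousLinearMap.comp_apply, map_sum] at h
    simp only [sum_apply, hadj]
    refine Eq.trans (Finset.sum_congr rfl fun i _ => ?_) (h.trans (U.symm_apply_apply ξ))
    change U.symm (S i (U (U.symm (ContinuousLinearMap.adjoint (S i) (U ξ))))) = _
    rw [U.apply_symm_apply]

end Operators

/-! ### The unitary equivalence -/

section Unitary

variable {N D : ℕ} {A : Matrix (Fin N) (Fin N) ℕ}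

/-- Composition with a measure preserving map is isometric; the almost everywhere inverse g supplies
preimages, hence surjectivity. -/
theorem exists_compositionUnitary {X Y : Type*} [MeasurableSpace X] [MeasurableSpace Y]
    {μ : Measure X} {ν : Measure Y} {f : X → Y} {g : Y → X} (hf : MeasurePreserving f μ ν)
    (hg : MeasurePreserving g ν μ) (hfg : ∀ᵐ y ∂ν, f (g y) = y) (hgf : ∀ᵐ x ∂μ, g (f x) = x) :
    ∃ U : Lp ℂ 2 ν ≃ₗᵢ[ℂ] Lp ℂ 2 μ, (∀ ξ : Lp ℂ 2 ν, U ξ =ᵐ[μ] ξ ∘ f) ∧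
      ∀ η : Lp ℂ 2 μ, U.symm η =ᵐ[ν] η ∘ g := by
  have hU (ξ : Lp ℂ 2 ν) : Lp.compMeasurePreservingₗᵢ ℂ f hf ξ =ᵐ[μ] ξ ∘ f :=
    Lp.coeFn_compMeasurePreserving ξ hf
  have hsurj : Function.Surjective (Lp.compMeasurePreservingₗᵢ (E := ℂ) (p := 2) ℂ f hf) := by
    refine fun η => ⟨Lp.compMeasurePreserving g hg η, Lp.ext ?_⟩
    filter_upwards [hU (Lp.compMeasurePreserving g hg η),
      hf.quasiMeasurePreserving.ae (Lp.coeFn_compMeasurePreserving η hg), hgf] with x h1 h2 h3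
    rw [h1, Function.comp_apply, h2, Function.comp_apply, h3]
  refine ⟨LinearIsometryEquiv.ofSurjective _ hsurj, hU, fun η => ?_⟩
  obtain ⟨ξ, rfl⟩ := (LinearIsometryEquiv.ofSurjective _ hsurj).surjective η
  rw [LinearIsometryEquiv.symm_apply_apply]
  filter_upwards [hg.quasiMeasurePreserving.ae (hU ξ), hfg] with y h1 h2
  refine Eq.trans ?_ h1.symm
  rw [Function.comp_apply, h2]

theorem exists_unitarily_equivalent_reps (hN : 2 ≤ N) [NeZero D] (lab : Fin D ≃o Symbols A)
    {τ : fractal A → fractal A} (hτ : IsCodingMap A τ) :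
    ∃ (S : Fin D → (Lp ℂ 2 (pathMeasure D) →L[ℂ] Lp ℂ 2 (pathMeasure D)))
      (T : Fin D → (Lp ℂ 2 (fractalMeasure A D) →L[ℂ] Lp ℂ 2 (fractalMeasure A D)))
      (U : Lp ℂ 2 (fractalMeasure A D) ≃ₗᵢ[ℂ] Lp ℂ 2 (pathMeasure D)),
      IsSemibranchingRep (pathMeasure D) (fun i : Fin D => pathPrepend i) pathShift S ∧
      IsSemibranchingRep (fractalMeasure A D) (fun i : Fin D => tauMap (lab i)) τ T ∧
      IsCuntzFamily S ∧ IsCuntzFamily T ∧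
      (∀ ξ : Lp ℂ 2 (fractalMeasure A D),
        (U ξ : FullPath D → ℂ) =ᵐ[pathMeasure D] (ξ : fractal A → ℂ) ∘ upsilon lab) ∧
      ∀ (i : Fin D) (ξ : Lp ℂ 2 (fractalMeasure A D)), U (T i ξ) = S i (U ξ) := by
  classical
  have := isProbabilityMeasure_fractalMeasure hN lab
  obtain ⟨G, s, hG, hG0, hs, hright, hleft⟩ := exists_section_upsilon hN lab
  have hG' : ∀ᵐ p ∂fractalMeasure A D, p ∈ G := mem_ae_iff.2 hG0
  have hΥ := measurePreserving_upsilon hN lab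
  obtain ⟨U, hU, hUsymm⟩ := exists_compositionUnitary hΥ hs (hG'.mono hright)
    ((hΥ.quasiMeasurePreserving.ae hG').mono hleft)
  obtain ⟨S, hS, hcuntz⟩ := exists_pathRep (D := D)
  refine ⟨S, _, U, fun i ξ => ?_, fun i ξ => ?_, hcuntz, hcuntz.conj U, hU,
    fun i ξ => U.apply_symm_apply _⟩
  · have hd : ∀ᵐ e ∂pathMeasure D,
        ((pathMeasure D).comap (pathPrepend i)).rnDeriv (pathMeasure D) e = (D : ℝ≥0∞)⁻¹ := by
      rw [comap_pathPrepend]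
      exact rnDeriv_inv_smul_self
    filter_upwards [hS i ξ, measurePreserving_pathShift.quasiMeasurePreserving.ae hd] with e h1 h2
    rw [h1, semibranchingFun_apply _ h2]
  · have hd : ∀ᵐ p ∂fractalMeasure A D,
        ((fractalMeasure A D).comap (tauMap (lab i))).rnDeriv (fractalMeasure A D) p =
          (D : ℝ≥0∞)⁻¹ := by
      rw [comap_tauMap hN]
      exact rnDeriv_inv_smul_self
    have hshift := measurePreserving_pathShift (D := D)
    filter_upwards [hUsymm (S i (U ξ)), hs.quasiMeasurePreserving.ae (hS i (U ξ)),
      (hshift.comp hs).quasiMeasurePreserving.ae (hU ξ),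
      (hΥ.comp (hshift.comp hs)).quasiMeasurePreserving.ae hd, hG'] with p h1 h2 h3 h4 hp
    obtain ⟨e, rfl⟩ := upsilon_surjective lab p
    have hinj : ∀ f, upsilon lab e = upsilon lab f → e = f := fun f hf => by
      rw [← hleft e hp, hf, hleft f (hf ▸ hp)]
    have hτe := codingMap_upsilon hN lab hτ hinj
    simp only [Function.comp_apply, hleft e hp] at h1 h2 h3 h4
    rw [semibranchingFun_apply _ (by rw [hτe]; exact h4), hτe, ← h3]
    refine h1.trans (h2.trans ?_)
    congr 1
    rw [Set.indicator_apply, Set.indicator_apply]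
    -- The path indicator and the fractal indicator agree at a uniquely coded point: it lies in the
    -- image of the similarity exactly when its only code starts with i.
    refine if_congr ⟨?_, ?_⟩ rfl rfl
    · rintro ⟨f, rfl⟩
      exact ⟨_, (upsilon_pathPrepend lab i f).symm⟩
    · rintro ⟨q, hq⟩
      obtain ⟨f, rfl⟩ := upsilon_surjective lab q
      rw [← upsilon_pathPrepend] at hq
      exact ⟨f, (hinj _ hq.symm).symm⟩

end Unitary

end SierpinskiCuntz

theorem mainTheorem2 (N D : ℕ) (hN : 2 ≤ N) (hD : 1 ≤ D)
    (A : Matrix (Fin N) (Fin N) ℕ) (hA : ∀ x y, A x y = 0 ∨ A x y = 1)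
    (lab : Fin D ≃o SierpinskiCuntz.Symbols A)
    (τ : SierpinskiCuntz.fractal A → SierpinskiCuntz.fractal A)
    (hτ : SierpinskiCuntz.IsCodingMap A τ) :
    (∀ μ : Measure (SierpinskiCuntz.FullPath D),
      (∀ (n : ℕ) (γ : (SierpinskiCuntz.fullDiagram D).FinitePath n),
        μ ((SierpinskiCuntz.fullDiagram D).cylinder n γ) = ((D : ℝ≥0∞) ^ (n + 1))⁻¹) ↔
      μ = SierpinskiCuntz.pathMeasure D) ∧
    dimH (SierpinskiCuntz.fractal A) = ENNReal.ofReal (Real.log D / Real.log N) ∧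
    SierpinskiCuntz.IsMeasureIso (SierpinskiCuntz.pathMeasure D)
      (SierpinskiCuntz.fractalMeasure A D) (SierpinskiCuntz.upsilon lab) ∧
    SierpinskiCuntz.IsSemibranching (SierpinskiCuntz.pathMeasure D)
      (fun i : Fin D => SierpinskiCuntz.pathPrepend i) SierpinskiCuntz.pathShift ∧
    SierpinskiCuntz.IsSemibranching (SierpinskiCuntz.fractalMeasure A D)
      (fun i : Fin D => SierpinskiCuntz.tauMap (lab i)) τ ∧
    ∃ (S : Fin D → (Lp ℂ 2 (SierpinskiCuntz.pathMeasure D) →L[ℂ]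
          Lp ℂ 2 (SierpinskiCuntz.pathMeasure D)))
      (T : Fin D → (Lp ℂ 2 (SierpinskiCuntz.fractalMeasure A D) →L[ℂ]
          Lp ℂ 2 (SierpinskiCuntz.fractalMeasure A D)))
      (U : Lp ℂ 2 (SierpinskiCuntz.fractalMeasure A D) ≃ₗᵢ[ℂ]
          Lp ℂ 2 (SierpinskiCuntz.pathMeasure D)),
      SierpinskiCuntz.IsSemibranchingRep (SierpinskiCuntz.pathMeasure D)
        (fun i : Fin D => SierpinskiCuntz.pathPrepend i) SierpinskiCuntz.pathShift S ∧
      SierpinskiCuntz.IsSemibranchingRep (SierpinskiCuntz.fractalMeasure A D)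
        (fun i : Fin D => SierpinskiCuntz.tauMap (lab i)) τ T ∧
      SierpinskiCuntz.IsCuntzFamily S ∧ SierpinskiCuntz.IsCuntzFamily T ∧
      (∀ ξ : Lp ℂ 2 (SierpinskiCuntz.fractalMeasure A D),
        (U ξ : SierpinskiCuntz.FullPath D → ℂ) =ᵐ[SierpinskiCuntz.pathMeasure D]
          (ξ : SierpinskiCuntz.fractal A → ℂ) ∘ SierpinskiCuntz.upsilon lab) ∧
      ∀ (i : Fin D) (ξ : Lp ℂ 2 (SierpinskiCuntz.fractalMeasure A D)), U (T i ξ) = S i (U ξ) := by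
  have : NeZero D := ⟨by omega⟩
  exact ⟨SierpinskiCuntz.forall_cylinder_iff_eq_pathMeasure,
    SierpinskiCuntz.dimH_fractal hN lab, SierpinskiCuntz.isMeasureIso_upsilon hN lab,
    SierpinskiCuntz.isSemibranching_path, SierpinskiCuntz.isSemibranching_fractal hN lab hτ,
    SierpinskiCuntz.exists_unitarily_equivalent_reps hN lab hτ⟩
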